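/- **Setting.** Let $n\ge 1$, $\theta\in\mathbb R^n$, and let $Y_i=\theta_i+\epsilon_i$, $i=1,\dots,n$, where $\epsilon_1,\dots,\epsilon_n$ are independent, mean-zero and sub-Gaussian: $\mathbb E[e^{t\epsilon_i}]\le e^{t^2/2}$ for all $t\in\mathbb R$. A *change-point vector* is a vector $\tau=(\tau_1,\dots,\tau_{|\tau|})$ of integers (possibly empty) with $1=\tau_0<\tau_1<\dots<\tau_{|\tau|}<\tau_{|\tau|+1}=n+1$. Let $\tau^*=(\tau^*_1,\dots,\tau^*_K)$ be the change-point vector of $\theta$, that is, $\theta_i=\mu_k$ for $\tau^*_{k-1}\le i<\tau^*_k$ ($1\le k\le K+1$) with $\mu_k\ne\mu_{k+1}$, and let $\Delta_k=\mu_{k+1}-\mu_k$ be the height of its $k$-th change-point. For integers $1\le t_1<t_2<t_3\le n+1$ and $q>0$ put $$\psi_q(t_1,t_2,t_3)=\sqrt{2\log\Big(\frac{n(t_3-t_1)}{(t_3-t_2)(t_2-t_1)}\Big)+q},\qquad \mathbf C(y,t)=\Big[\frac{\sum_{i=t_2}^{t_3-1}y_i}{t_3-t_2}-\frac{\sum_{i=t_1}^{t_2-1}y_i}{t_2-t_1}\Big]\sqrt{\frac{(t_2-t_1)(t_3-t_2)}{t_3-t_1}}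 .$$ The change-point $\tau^*_k$ has *$(\kappa,q)$-high energy* if $|\mathbf C(\theta,(\tau^*_{k-1},\tau^*_k,\tau^*_{k+1}))|>\kappa\,\psi_q(\tau^*_{k-1},\tau^*_k,\tau^*_{k+1})$. Let $\mathcal A_q$ be the event that $|\mathbf C(\epsilon,t)|\le 2\psi_q(t)$ for all triads $t=(t_1,t_2,t_3)$ with $1\le t_1<t_2<t_3\le n+1$. The penalized least-squares estimator $\widehat\tau$ with parameters $L$ and $q$ is any minimizer, over all change-point vectors $\tau$, of $$\|Y-\Pi_\tau Y\|^2+L\Big[q|\tau|+2\sum_{i=1}^{|\tau|+1}\log\Big(\frac{n}{\tau_i-\tau_{i-1}}\Big)\Big],$$ where $\Pi_\tau$ is the orthogonal projection onto the vectors that are constant on each $\{\tau_{i-1},\dots,\tau_i-1\}$. Finally $d_{H,1}(\tau,s)=\min_{1\le l\le|\tau|}|\tau_l-s|$ (equal to $+\infty$ if $\tau$ is empty). **Proposition.** There exist universal constants $L_0>1$, $q_0>0$, $c>0$, $c'>0$ and, for each $L$, a constant $\kappa_L>1$ depending only on $L$, such that for all $L\ge L_0$, $q>q_0$, $n\ge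 1$, all $\theta\in\mathbb R^n$, all noise distributions as above, and every $(\kappa_L,q)$-high-energy change-point $\tau^*_k$ of $\theta$, the penalized least-squares estimator $\widehat\tau$ with parameters $L$ and $q$ satisfies $$\mathbb P\big(d_{H,1}(\widehat\tau,\tau^*_k)\,\mathbf 1_{\mathcal A_q}\ge c\,x\,\Delta_k^{-2}\big)\le c'e^{-x}\qquad\text{for all }x\ge 1 .$$ -/

import Mathlib

open MeasureTheory ProbabilityTheory
open scoped ENNReal

noncomputable section

namespace ChangePoint

/-- A change-point vector `(τ₁, …, τ_len)` of integers, stored together with the two conventional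
end points: `1 = τ₀ < τ₁ < ⋯ < τ_len < τ_{len+1} = n + 1`. -/
structure CPVector (n : ℕ) where
  len : ℕ
  pt : Fin (len + 2) → ℕ
  strictMono : StrictMono pt
  pt_zero : pt 0 = 1
  pt_last : pt (Fin.last (len + 1)) = n + 1

namespace CPVector

variable {n : ℕ} (τ : CPVector n)

/-- The change-point `τ_{k+1}`, for `k = 0, …, len - 1`. -/
def cp (k : Fin τ.len) : ℕ := τ.pt k.castSucc.succ

/-- The left neighbour of `cp k`. -/
def prev (k : Fin τ.len) : ℕ := τ.pt k.castSucc.castSucc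

/-- The right neighbour of `cp k`. -/
def next (k : Fin τ.len) : ℕ := τ.pt k.succ.succ

/-- The coordinate `i : Fin n`, that is the time `i + 1` of `{1, …, n}`, lies in the `j`-th segment
of `τ`, the integer interval from `pt j` (included) to `pt (j + 1)` (excluded). -/
def InSegment (j : Fin (τ.len + 1)) (i : Fin n) : Prop :=
  τ.pt j.castSucc ≤ (i : ℕ) + 1 ∧ (i : ℕ) + 1 < τ.pt j.succ

/-- The space of vectors that are constant on each segment of `τ`. -/
def pieceSpace : Submodule ℝ (EuclideanSpace ℝ (Fin n)) where
  carrier := {v | ∀ j i i', τ.InSegment j i → τ.InSegment j i' → v i = v i'}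
  add_mem' := by
    intro a b ha hb j i i' h h'
    simp [ha j i i' h h', hb j i i' h h']
  zero_mem' := by
    intro j i i' _ _
    rfl
  smul_mem' := by
    intro c a ha j i i' h h'
    simp [ha j i i' h h']

/-- The multiscale penalty `q |τ| + 2 ∑ log (n / (τ_i - τ_{i-1}))`. -/
def penalty (q : ℝ) : ℝ :=
  q * (τ.len : ℝ) +
    2 * ∑ j : Fin (τ.len + 1),
      Real.log ((n : ℝ) / ((τ.pt j.succ : ℝ) - (τ.pt j.castSucc : ℝ)))

/-- The penalized least-squares criterion `‖Y - Π_τ Y‖² + L pen(τ, q)`. -/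
def criterion (L q : ℝ) (Y : EuclideanSpace ℝ (Fin n)) : ℝ :=
  ‖Y - τ.pieceSpace.starProjection Y‖ ^ 2 + L * τ.penalty q

/-- The distance from `s` to the closest change-point of `τ`; it is `∞` if `τ` has none. -/
def dist1 (s : ℕ) : ℝ≥0∞ :=
  ⨅ l : Fin τ.len, ENNReal.ofReal |(τ.cp l : ℝ) - (s : ℝ)|

end CPVector

variable {n : ℕ}

/-- `τ` minimizes the penalized least-squares criterion over all change-point vectors. -/
def IsPenalizedLSE (L q : ℝ) (Y : EuclideanSpace ℝ (Fin n)) (τ : CPVector n) : Prop :=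
  ∀ σ : CPVector n, τ.criterion L q Y ≤ σ.criterion L q Y

/-- `τ` is the vector of change-points of `θ` and `μ` the vector of its successive values, with
consecutive values distinct. -/
def IsChangePointRep (θ : EuclideanSpace ℝ (Fin n)) (τ : CPVector n)
    (μ : Fin (τ.len + 1) → ℝ) : Prop :=
  (∀ k : Fin τ.len, μ k.castSucc ≠ μ k.succ) ∧
    ∀ j i, τ.InSegment j i → θ i = μ j

/-- The mean of the coordinates of `y` at the times `a, …, b - 1`. -/
def segMean (y : EuclideanSpace ℝ (Fin n)) (a b : ℕ) : ℝ :=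
  (∑ i : Fin n, if a ≤ (i : ℕ) + 1 ∧ (i : ℕ) + 1 < b then y i else 0) / ((b : ℝ) - (a : ℝ))

/-- The CUSUM statistic of `y` at the triad `(t₁, t₂, t₃)`. -/
def cusum (y : EuclideanSpace ℝ (Fin n)) (t₁ t₂ t₃ : ℕ) : ℝ :=
  (segMean y t₂ t₃ - segMean y t₁ t₂) *
    √((((t₂ : ℝ) - t₁) * ((t₃ : ℝ) - t₂)) / ((t₃ : ℝ) - t₁))

/-- The energy of `θ` at the triad `(t₁, t₂, t₃)`. -/
def energy (θ : EuclideanSpace ℝ (Fin n)) (t₁ t₂ t₃ : ℕ) : ℝ :=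
  |segMean θ t₂ t₃ - segMean θ t₁ t₂| *
    √((((t₂ : ℝ) - t₁) * ((t₃ : ℝ) - t₂)) / ((t₃ : ℝ) - t₁))

/-- `√(2 log (n (t₃ - t₁) / ((t₃ - t₂) (t₂ - t₁))) + q)`. -/
def threshold (n : ℕ) (q : ℝ) (t₁ t₂ t₃ : ℕ) : ℝ :=
  √(2 * Real.log (((n : ℝ) * ((t₃ : ℝ) - t₁)) / (((t₃ : ℝ) - t₂) * ((t₂ : ℝ) - t₁))) + q)

/-- The `k`-th change-point of `θ` (with change-point vector `τ`) has `(κ, q)`-high energy. -/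
def IsHighEnergy (κ q : ℝ) (θ : EuclideanSpace ℝ (Fin n)) (τ : CPVector n)
    (k : Fin τ.len) : Prop :=
  κ * threshold n q (τ.prev k) (τ.cp k) (τ.next k) < energy θ (τ.prev k) (τ.cp k) (τ.next k)

/-- The noise vector at the sample point `ω`. -/
def noiseVec {Ω : Type*} (ε : Fin n → Ω → ℝ) (ω : Ω) : EuclideanSpace ℝ (Fin n) :=
  WithLp.toLp 2 fun i => ε i ω

/-- The event that the CUSUM statistics of the noise are at most twice the threshold, simultaneously
over all triads `1 ≤ t₁ < t₂ < t₃ ≤ n + 1`. -/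
def noiseEvent {Ω : Type*} (ε : Fin n → Ω → ℝ) (q : ℝ) : Set Ω :=
  {ω | ∀ t₁ t₂ t₃ : ℕ, 1 ≤ t₁ → t₁ < t₂ → t₂ < t₃ → t₃ ≤ n + 1 →
    |cusum (noiseVec ε ω) t₁ t₂ t₃| ≤ 2 * threshold n q t₁ t₂ t₃}

end ChangePoint

end

noncomputable section

namespace ChangePoint

/-! The proof has a deterministic half and a probabilistic half. Fix a high-energy change-point `s`
with jump `Δ`, let `m` be the distance to its nearest neighbour in the true segmentation, and let
`r` be of order `x / Δ ^ 2`. In probability (`measure_exists_psum_gt_le`), an exponential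
supermartingale shows that beyond distance `r` the noise sums started at `s` stay below a line of
slope `|Δ| / 16`, outside an event of probability at most `4 * exp (-x)`. There is no union bound
over positions, hence no logarithm in the rate. The deterministic half (`LocalConfig.elim`) shows
that on the remaining event intersected with `noiseEvent`, a minimizer cannot avoid the
`r`-neighbourhood of `s`. Up to constants its criterion is a sum of segment costs, so optimality is
used only through a few local changes: inserting, removing or moving a node, and replacing two nodes
by one. Some node is close to `s` on the scale `m`, since otherwise inserting `s` and two auxiliary
nodes would pay (`exists_near`). Two nodes close to `s` cannot lie on the same side, since the inner
gap between them would be fitted to noise (`not_consec_near`). Let `u < s < t` be the nodes around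
`s`, with `t` the nearer. Moving `t` to `s` reduces the residuals by at least a multiple of `(t - s)
* Δ ^ 2`, and raises the penalty by at most `2 * L * (t - s) / (s - u)`. This alone is no
contradiction when `u` is near, but it forces `(s - u) * Δ ^ 2 ≤ 32 * L`. Then `u` is near too, and
replacing both `u` and `t` by `s` loses at most `4 * L` in residuals while it saves at least `L * q`
in penalty, which is impossible for `q > 10`. -/

/-! ### Algebra of segment means and CUSUM statistics. -/

/-- The mean over `[a, b)` of the sequence whose partial sums are `F`. -/
def avg (F : ℤ → ℝ) (a b : ℤ) : ℝ := (F b - F a) / ((b : ℝ) - a)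

/-- The energy explained by the mean over `[a, b)`; it is `0` for `a = b`. -/
def explained (F : ℤ → ℝ) (a b : ℤ) : ℝ := (F b - F a) ^ 2 / ((b : ℝ) - a)

/-- The square of the CUSUM statistic, in terms of partial sums. -/
def cusumSq (F : ℤ → ℝ) (a b c : ℤ) : ℝ :=
  explained F a b + explained F b c - explained F a c

/-- The square of the threshold. -/
def thresholdSq (n q : ℝ) (a b c : ℤ) : ℝ :=
  q + 2 * (Real.log n + Real.log ((c : ℝ) - a) - Real.log ((c : ℝ) - b) - Real.log ((b : ℝ) - a))

/-- The contribution of the segment `[a, b)` to the penalized criterion. -/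
def segCost (F : ℤ → ℝ) (n L : ℝ) (a b : ℤ) : ℝ :=
  -explained F a b + 2 * L * Real.log (n / ((b : ℝ) - a))

/-- `a < b` are consecutive elements of `N`. -/
def Consec (N : Set ℤ) (a b : ℤ) : Prop :=
  a ∈ N ∧ b ∈ N ∧ a < b ∧ ∀ p ∈ N, p ≤ a ∨ b ≤ p

lemma cusumSq_eq (F : ℤ → ℝ) {a b c : ℤ} (hab : a < b) (hbc : b < c) :
    cusumSq F a b c =
      (avg F b c - avg F a b) ^ 2 * (((b : ℝ) - a) * ((c : ℝ) - b) / ((c : ℝ) - a)) := by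
  have h1 : (0 : ℝ) < (b : ℝ) - a := sub_pos.2 (by exact_mod_cast hab)
  have h2 : (0 : ℝ) < (c : ℝ) - b := sub_pos.2 (by exact_mod_cast hbc)
  have h3 : (c : ℝ) - a = ((b : ℝ) - a) + ((c : ℝ) - b) := by ring
  have h4 : (0 : ℝ) < ((b : ℝ) - a) + ((c : ℝ) - b) := by positivity
  unfold cusumSq explained avg
  rw [h3]
  generalize (b : ℝ) - a = x at *
  generalize (c : ℝ) - b = y at *
  field_simp
  ring

lemma cusumSq_nonneg (F : ℤ → ℝ) {a b c : ℤ} (hab : a < b) (hbc : b < c) :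
    0 ≤ cusumSq F a b c := by
  have h1 : (0 : ℝ) < (b : ℝ) - a := sub_pos.2 (by exact_mod_cast hab)
  have h2 : (0 : ℝ) < (c : ℝ) - b := sub_pos.2 (by exact_mod_cast hbc)
  have h3 : (0 : ℝ) < (c : ℝ) - a := by linarith
  rw [cusumSq_eq F hab hbc]
  positivity

/-- Cutting `[a, c)` at `b` explains a between-group sum of squares, and the left side is the share
of the first group. This turns the absence of a profitable cut into closeness of the mean over a
long segment to the mean over a part of it. -/
lemma sq_avg_sub_left_le (F : ℤ → ℝ) {a b c : ℤ} (hab : a < b) (hbc : b < c) :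
    (avg F a c - avg F a b) ^ 2 * ((b : ℝ) - a) ≤ cusumSq F a b c := by
  have h1 : (0 : ℝ) < (b : ℝ) - a := sub_pos.2 (by exact_mod_cast hab)
  have h2 : (0 : ℝ) < (c : ℝ) - b := sub_pos.2 (by exact_mod_cast hbc)
  have h3 : (c : ℝ) - a = ((b : ℝ) - a) + ((c : ℝ) - b) := by ring
  have h4 : (0 : ℝ) < ((b : ℝ) - a) + ((c : ℝ) - b) := by positivity
  have key : (avg F a c - avg F a b) ^ 2 * ((b : ℝ) - a) =
      cusumSq F a b c * (((c : ℝ) - b) / ((c : ℝ) - a)) := by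
    unfold cusumSq explained avg
    rw [h3]
    generalize (b : ℝ) - a = x at *
    generalize (c : ℝ) - b = y at *
    field_simp
    ring
  rw [key]
  refine mul_le_of_le_one_right (cusumSq_nonneg F hab hbc) ?_
  rw [h3, div_le_one h4]
  linarith

lemma sq_avg_sub_right_le (F : ℤ → ℝ) {a b c : ℤ} (hab : a < b) (hbc : b < c) :
    (avg F b c - avg F a c) ^ 2 * ((c : ℝ) - b) ≤ cusumSq F a b c := by
  have h1 : (0 : ℝ) < (b : ℝ) - a := sub_pos.2 (by exact_mod_cast hab)
  have h2 : (0 : ℝ) < (c : ℝ) - b := sub_pos.2 (by exact_mod_cast hbc)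
  have h3 : (c : ℝ) - a = ((b : ℝ) - a) + ((c : ℝ) - b) := by ring
  have h4 : (0 : ℝ) < ((b : ℝ) - a) + ((c : ℝ) - b) := by positivity
  have key : (avg F b c - avg F a c) ^ 2 * ((c : ℝ) - b) =
      cusumSq F a b c * (((b : ℝ) - a) / ((c : ℝ) - a)) := by
    unfold cusumSq explained avg
    rw [h3]
    generalize (b : ℝ) - a = x at *
    generalize (c : ℝ) - b = y at *
    field_simp
    ring
  rw [key]
  refine mul_le_of_le_one_right (cusumSq_nonneg F hab hbc) ?_
  rw [h3, div_le_one h4]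
  linarith

lemma cusumSq_le_left (F : ℤ → ℝ) {a b c : ℤ} (hab : a < b) (hbc : b < c) :
    cusumSq F a b c ≤ (avg F b c - avg F a b) ^ 2 * ((b : ℝ) - a) := by
  have h1 : (0 : ℝ) < (b : ℝ) - a := sub_pos.2 (by exact_mod_cast hab)
  have h2 : (0 : ℝ) < (c : ℝ) - b := sub_pos.2 (by exact_mod_cast hbc)
  have h3 : (0 : ℝ) < (c : ℝ) - a := by linarith
  rw [cusumSq_eq F hab hbc]
  refine mul_le_mul_of_nonneg_left ?_ (sq_nonneg _)
  rw [div_le_iff₀ h3]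
  refine mul_le_mul_of_nonneg_left ?_ h1.le
  linarith

/-! ### The local situation around one change-point, and its symmetry. -/

/-- A window of half-width `m` around the change-point `s`, in which the signal takes the values
`μ₁` on the left of `s` and `μ₂` on its right. `F` and `E` are the partial sums of the observations
and of the noise, and `N` is the set of nodes of a segmentation that no local change improves. The
field `far` is the situation that `LocalConfig.elim` excludes: no node in the window is closer to
`s` than `r`. -/
structure LocalConfig (F E : ℤ → ℝ) (N : Set ℤ) (n L q μ₁ μ₂ r : ℝ) (s m : ℤ) : Prop where
  hL : 100 ≤ L
  hq : 10 < q
  one_le : 1 ≤ m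
  le_n : (m : ℝ) ≤ n
  signal : 1000000 * L * (q + 2 * Real.log (n / m)) ≤ (μ₂ - μ₁) ^ 2 * m
  left : ∀ p, s - m ≤ p → p ≤ s → F p - F s = μ₁ * ((p : ℝ) - s) + (E p - E s)
  right : ∀ p, s ≤ p → p ≤ s + m → F p - F s = μ₂ * ((p : ℝ) - s) + (E p - E s)
  noise : ∀ a b c, s - m ≤ a → a < b → b < c → c ≤ s + m →
    cusumSq E a b c ≤ 4 * thresholdSq n q a b c
  dev : ∀ p, s - m ≤ p → p ≤ s + m → r ≤ |(p : ℝ) - s| →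
    |E p - E s| ≤ 1 / 16 * |μ₂ - μ₁| * |(p : ℝ) - s|
  far : ∀ p ∈ N, |(p : ℝ) - s| < m → r ≤ |(p : ℝ) - s|
  r_pos : 0 < r
  consec_le : ∀ u v, Consec N u v → (v : ℝ) - u ≤ n
  bracket : ∃ u v, Consec N u v ∧ u < s ∧ s < v
  next : ∀ t ∈ N, t < s + m → ∃ v, Consec N t v
  prev : ∀ t ∈ N, s - m < t → ∃ u, Consec N u t
  ins : ∀ u v w, Consec N u v → u < w → w < v →
    segCost F n L u v ≤ segCost F n L u w + segCost F n L w v + L * q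
  ins₃ : ∀ u v l t w, Consec N u v → u ≤ l → l < t → t < w → w ≤ v →
    segCost F n L u v ≤ segCost F n L u l + segCost F n L l t + segCost F n L t w +
      segCost F n L w v + 3 * (L * q)
  rem : ∀ u t v, Consec N u t → Consec N t v →
    segCost F n L u t + segCost F n L t v + L * q ≤ segCost F n L u v
  move : ∀ u t v w, Consec N u t → Consec N t v → u < w → w < v →
    segCost F n L u t + segCost F n L t v ≤ segCost F n L u w + segCost F n L w v
  merge : ∀ u' u t v w, Consec N u' u → Consec N u t → Consec N t v → u' < w → w < v →
    segCost F n L u' u + segCost F n L u t + segCost F n L t v + L * q ≤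
      segCost F n L u' w + segCost F n L w v

/-- The reflection `p ↦ -p` of partial sums. -/
def reflect (F : ℤ → ℝ) : ℤ → ℝ := fun p => -F (-p)

lemma avg_reflect (F : ℤ → ℝ) (a b : ℤ) : avg (reflect F) a b = avg F (-b) (-a) := by
  unfold avg reflect
  push_cast
  congr 1 <;> ring

lemma explained_reflect (F : ℤ → ℝ) (a b : ℤ) :
    explained (reflect F) a b = explained F (-b) (-a) := by
  unfold explained reflect
  push_cast
  congr 1 <;> ring

lemma cusumSq_reflect (F : ℤ → ℝ) (a b c : ℤ) :
    cusumSq (reflect F) a b c = cusumSq F (-c) (-b) (-a) := by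
  unfold cusumSq
  simp only [explained_reflect]
  ring

lemma segCost_reflect (F : ℤ → ℝ) (n L : ℝ) (a b : ℤ) :
    segCost (reflect F) n L a b = segCost F n L (-b) (-a) := by
  unfold segCost
  rw [explained_reflect]
  push_cast
  congr 4
  ring

lemma thresholdSq_reflect (n q : ℝ) (a b c : ℤ) :
    thresholdSq n q a b c = thresholdSq n q (-c) (-b) (-a) := by
  unfold thresholdSq
  push_cast
  rw [show -(a : ℝ) - -(c : ℝ) = c - a by ring, show -(a : ℝ) - -(b : ℝ) = b - a by ring,
    show -(b : ℝ) - -(c : ℝ) = c - b by ring]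
  ring

lemma Consec.reflect {N : Set ℤ} {a b : ℤ} (h : Consec {p | -p ∈ N} a b) :
    Consec N (-b) (-a) := by
  obtain ⟨h1, h2, h3, h4⟩ := h
  refine ⟨h2, h1, by omega, fun p hp => ?_⟩
  have := h4 (-p) (by simpa using hp)
  omega

lemma Consec.reflect' {N : Set ℤ} {a b : ℤ} (h : Consec N a b) :
    Consec {p | -p ∈ N} (-b) (-a) := by
  obtain ⟨h1, h2, h3, h4⟩ := h
  refine ⟨by simpa using h2, by simpa using h1, by omega, fun p hp => ?_⟩
  have := h4 (-p) hp
  omega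

namespace LocalConfig

variable {F E : ℤ → ℝ} {N : Set ℤ} {n L q μ₁ μ₂ r : ℝ} {s m : ℤ}

/-- Reversing time exchanges `μ₁` and `μ₂` and maps the list of local changes to itself. Each
estimate therefore needs a proof on one side of `s` only. -/
protected lemma reflect (C : LocalConfig F E N n L q μ₁ μ₂ r s m) :
    LocalConfig (reflect F) (reflect E) {p | -p ∈ N} n L q μ₂ μ₁ r (-s) m where
  hL := C.hL
  hq := C.hq
  one_le := C.one_le
  le_n := C.le_n
  signal := by
    have := C.signal
    rwa [show (μ₁ - μ₂) ^ 2 = (μ₂ - μ₁) ^ 2 by ring]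
  left p h1 h2 := by
    have := C.right (-p) (by omega) (by omega)
    unfold ChangePoint.reflect
    push_cast at this ⊢
    simp only [neg_neg]
    linarith
  right p h1 h2 := by
    have := C.left (-p) (by omega) (by omega)
    unfold ChangePoint.reflect
    push_cast at this ⊢
    simp only [neg_neg]
    linarith
  noise a b c h1 h2 h3 h4 := by
    rw [cusumSq_reflect, thresholdSq_reflect]
    exact C.noise _ _ _ (by omega) (by omega) (by omega) (by omega)
  dev p h1 h2 h3 := by
    have e : |(p : ℝ) - ((-s : ℤ) : ℝ)| = |((-p : ℤ) : ℝ) - s| := by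
      rw [abs_sub_comm]
      push_cast
      congr 1
      ring
    rw [e] at h3 ⊢
    have := C.dev (-p) (by omega) (by omega) h3
    unfold ChangePoint.reflect
    rw [neg_neg, abs_sub_comm μ₁, show -E (-p) - -E s = -(E (-p) - E s) by ring, abs_neg]
    exact this
  far p h1 h2 := by
    have e : |(p : ℝ) - ((-s : ℤ) : ℝ)| = |((-p : ℤ) : ℝ) - s| := by
      rw [abs_sub_comm]
      push_cast
      congr 1
      ring
    rw [e] at h2 ⊢
    exact C.far (-p) h1 h2
  r_pos := C.r_pos
  consec_le u v h := by
    have := C.consec_le _ _ h.reflect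
    push_cast at this
    linarith
  bracket := by
    obtain ⟨u, v, h, h1, h2⟩ := C.bracket
    exact ⟨-v, -u, h.reflect', by omega, by omega⟩
  next t ht h := by
    obtain ⟨u, hu⟩ := C.prev (-t) ht (by omega)
    exact ⟨-u, by simpa using hu.reflect'⟩
  prev t ht h := by
    obtain ⟨u, hu⟩ := C.next (-t) ht (by omega)
    exact ⟨-u, by simpa using hu.reflect'⟩
  ins u v w h h1 h2 := by
    simp only [segCost_reflect]
    have := C.ins _ _ (-w) h.reflect (by omega) (by omega)
    linarith
  ins₃ u v l t w h h1 h2 h3 h4 := by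
    simp only [segCost_reflect]
    have := C.ins₃ _ _ (-w) (-t) (-l) h.reflect (by omega) (by omega) (by omega) (by omega)
    linarith
  rem u t v h h' := by
    simp only [segCost_reflect]
    have := C.rem _ _ _ h'.reflect h.reflect
    linarith
  move u t v w h h' h1 h2 := by
    simp only [segCost_reflect]
    have := C.move _ _ _ (-w) h'.reflect h.reflect (by omega) (by omega)
    linarith
  merge u' u t v w h h' h'' h1 h2 := by
    simp only [segCost_reflect]
    have := C.merge _ _ _ _ (-w) h''.reflect h'.reflect h.reflect (by omega) (by omega)
    linarith

end LocalConfig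

lemma cusumSq_le_right (F : ℤ → ℝ) {a b c : ℤ} (hab : a < b) (hbc : b < c) :
    cusumSq F a b c ≤ (avg F b c - avg F a b) ^ 2 * ((c : ℝ) - b) := by
  have h1 : (0 : ℝ) < (b : ℝ) - a := sub_pos.2 (by exact_mod_cast hab)
  have h2 : (0 : ℝ) < (c : ℝ) - b := sub_pos.2 (by exact_mod_cast hbc)
  have h3 : (0 : ℝ) < (c : ℝ) - a := by linarith
  rw [cusumSq_eq F hab hbc]
  refine mul_le_mul_of_nonneg_left ?_ (sq_nonneg _)
  rw [div_le_iff₀ h3, mul_comm]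
  refine mul_le_mul_of_nonneg_left ?_ h2.le
  linarith

lemma explained_le_add (F : ℤ → ℝ) {a b c : ℤ} (hab : a ≤ b) (hbc : b ≤ c) :
    explained F a c ≤ explained F a b + explained F b c := by
  rcases hab.eq_or_lt with rfl | hab
  · simp [explained]
  rcases hbc.eq_or_lt with rfl | hbc
  · simp [explained]
  have := cusumSq_nonneg F hab hbc
  unfold cusumSq at this
  linarith

lemma sub_cast_pos {a b : ℤ} (h : a < b) : (0 : ℝ) < (b : ℝ) - a :=
  sub_pos.2 (by exact_mod_cast h)

lemma segCost_eq (F : ℤ → ℝ) {n : ℝ} (L : ℝ) {a b : ℤ} (hn : 0 < n) (h : a < b) :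
    segCost F n L a b =
      -explained F a b + 2 * L * (Real.log n - Real.log ((b : ℝ) - a)) := by
  rw [segCost, Real.log_div hn.ne' (sub_cast_pos h).ne']

lemma log_two_lt : Real.log 2 < 0.7 := by
  have := Real.log_two_lt_d9
  linarith

/-- Comparing lengths up to a factor `2 ^ k` costs `0.7 * k` in the logarithms; these numerical
losses are later absorbed by `q > 10`. -/
lemma log_le_of_le_two_pow_mul {x y : ℝ} (k : ℕ) (hx : 0 < x) (hy : 0 < y)
    (h : x ≤ 2 ^ k * y) : Real.log x ≤ k * 0.7 + Real.log y := by
  have h1 := Real.log_le_log hx h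
  rw [Real.log_mul (by positivity) hy.ne', Real.log_pow] at h1
  have h2 : (k : ℝ) * Real.log 2 ≤ k * 0.7 :=
    mul_le_mul_of_nonneg_left log_two_lt.le (Nat.cast_nonneg k)
  linarith

/-! ### The deterministic contradiction near the change-point. -/

namespace LocalConfig

variable {F E : ℤ → ℝ} {N : Set ℤ} {n L q μ₁ μ₂ r : ℝ} {s m : ℤ}

lemma m_pos (C : LocalConfig F E N n L q μ₁ μ₂ r s m) : (0 : ℝ) < m := by
  exact_mod_cast C.one_le

lemma n_pos (C : LocalConfig F E N n L q μ₁ μ₂ r s m) : 0 < n :=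
  C.m_pos.trans_le C.le_n

lemma log_ratio (C : LocalConfig F E N n L q μ₁ μ₂ r s m) :
    Real.log (n / m) = Real.log n - Real.log m :=
  Real.log_div C.n_pos.ne' C.m_pos.ne'

lemma log_ratio_nonneg (C : LocalConfig F E N n L q μ₁ μ₂ r s m) :
    0 ≤ Real.log n - Real.log m :=
  sub_nonneg.2 (Real.log_le_log C.m_pos C.le_n)

/-- Since no insertion pays, a segment has no large CUSUM inside. Dually, since no removal pays,
every node has a large one (`le_cusumSq_of_consec`). -/
lemma cusumSq_le_of_consec (C : LocalConfig F E N n L q μ₁ μ₂ r s m) {u v w : ℤ}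
    (h : Consec N u v) (h1 : u < w) (h2 : w < v) :
    cusumSq F u w v ≤ L * thresholdSq n q u w v := by
  have := C.ins u v w h h1 h2
  rw [segCost_eq F L C.n_pos h1, segCost_eq F L C.n_pos h2, segCost_eq F L C.n_pos (h1.trans h2)]
    at this
  unfold cusumSq thresholdSq
  linarith

lemma le_cusumSq_of_consec (C : LocalConfig F E N n L q μ₁ μ₂ r s m) {u t v : ℤ}
    (h : Consec N u t) (h' : Consec N t v) :
    L * thresholdSq n q u t v ≤ cusumSq F u t v := by
  have h1 := h.2.2.1
  have h2 := h'.2.2.1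
  have := C.rem u t v h h'
  rw [segCost_eq F L C.n_pos h1, segCost_eq F L C.n_pos h2, segCost_eq F L C.n_pos (h1.trans h2)]
    at this
  unfold cusumSq thresholdSq
  linarith

lemma avg_right (C : LocalConfig F E N n L q μ₁ μ₂ r s m) {a b : ℤ} (ha : s ≤ a) (hab : a < b)
    (hb : b ≤ s + m) : avg F a b = μ₂ + avg E a b := by
  have h1 := C.right a ha (by omega)
  have h2 := C.right b (by omega) hb
  have h3 := (sub_cast_pos hab).ne'
  unfold avg
  rw [show F b - F a = μ₂ * ((b : ℝ) - a) + (E b - E a) by linarith, add_div,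
    mul_div_cancel_right₀ _ h3]

lemma avg_left (C : LocalConfig F E N n L q μ₁ μ₂ r s m) {a b : ℤ} (ha : s - m ≤ a) (hab : a < b)
    (hb : b ≤ s) : avg F a b = μ₁ + avg E a b := by
  have := C.reflect.avg_right (a := -b) (b := -a) (by omega) (by omega) (by omega)
  simpa [avg_reflect] using this

/-- Averages of the noise over long intervals that start close to `s` are small. -/
lemma abs_avg_noise_le (C : LocalConfig F E N n L q μ₁ μ₂ r s m) {a b : ℤ}
    (hr : r ≤ (a : ℝ) - s) (h : 3 * (a - s) ≤ b - s) (hb : b ≤ s + m) :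
    |avg E a b| ≤ 1 / 8 * |μ₂ - μ₁| := by
  have hr0 := C.r_pos
  have has : s < a := by
    have : (0 : ℝ) < (a : ℝ) - s := by linarith
    have : (s : ℝ) < a := by linarith
    exact_mod_cast this
  have hab : a < b := by omega
  have hR : 3 * ((a : ℝ) - s) ≤ (b : ℝ) - s := by exact_mod_cast h
  have ha0 := sub_cast_pos has
  have d1 := C.dev a (by omega) (by omega) (by rwa [abs_of_pos ha0])
  have d2 := C.dev b (by omega) hb (by rw [abs_of_pos (by linarith)]; linarith)
  rw [abs_of_pos ha0] at d1
  rw [abs_of_pos (by linarith : (0 : ℝ) < (b : ℝ) - s)] at d2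
  have hb0 := sub_cast_pos hab
  unfold avg
  rw [abs_div, abs_of_pos hb0, div_le_iff₀ hb0]
  have d3 : |E b - E a| ≤ |E b - E s| + |E a - E s| := by
    rw [abs_sub_comm (E a)]
    exact abs_sub_le _ _ _
  -- The bound needs `(b - s) + (a - s) ≤ 2 * (b - a)`, which is the hypothesis `3 * (a - s) ≤ b -
  -- s` rearranged.
  have := abs_nonneg (μ₂ - μ₁)
  nlinarith

lemma abs_avg_noise_self_le (C : LocalConfig F E N n L q μ₁ μ₂ r s m) {b : ℤ}
    (hsb : s < b) (hr : r ≤ (b : ℝ) - s) (hb : b ≤ s + m) :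
    |avg E s b| ≤ 1 / 16 * |μ₂ - μ₁| := by
  have hb0 := sub_cast_pos hsb
  have d2 := C.dev b (by have := C.one_le; omega) hb (by rwa [abs_of_pos hb0])
  unfold avg
  rw [abs_div, div_le_iff₀ (abs_pos.2 hb0.ne')]
  exact d2

lemma thresholdSq_le_two_mul (C : LocalConfig F E N n L q μ₁ μ₂ r s m) {t w v : ℤ}
    (h1 : m ≤ 4 * (w - t)) (h2 : w - t ≤ v - w) :
    thresholdSq n q t w v ≤ 2 * (q + 2 * Real.log (n / m)) := by
  have hm := C.one_le
  have htw : t < w := by omega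
  have hwv : w < v := by omega
  have e1 : Real.log ((v : ℝ) - t) ≤ (1 : ℕ) * 0.7 + Real.log ((v : ℝ) - w) := by
    refine log_le_of_le_two_pow_mul 1 (sub_cast_pos (htw.trans hwv)) (sub_cast_pos hwv) ?_
    have : ((w : ℝ) - t) ≤ (v : ℝ) - w := by exact_mod_cast h2
    linarith
  have e2 : Real.log m ≤ (2 : ℕ) * 0.7 + Real.log ((w : ℝ) - t) := by
    refine log_le_of_le_two_pow_mul 2 C.m_pos (sub_cast_pos htw) ?_
    have : (m : ℝ) ≤ 4 * ((w : ℝ) - t) := by exact_mod_cast h1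
    linarith
  have := C.hq
  have := C.log_ratio_nonneg
  rw [C.log_ratio]
  unfold thresholdSq
  push_cast at e1 e2
  linarith

/-- The mean of the observations over a segment of `N` that starts close to `s` and is not short
is close to `μ₂`. -/
lemma abs_avg_sub_le (C : LocalConfig F E N n L q μ₁ μ₂ r s m) {t v : ℤ} (h : Consec N t v)
    (hst : s < t) (ht : 256 * (t - s) < m) (hv : m ≤ 64 * (v - s)) :
    |avg F t v - μ₂| ≤ 3 / 16 * |μ₂ - μ₁| := by
  have htv := h.2.2.1
  have ht0 := sub_cast_pos hst
  have hr : r ≤ (t : ℝ) - s := by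
    have := C.far t h.1 (by
      rw [abs_of_pos ht0]
      have : t - s < m := by omega
      exact_mod_cast this)
    rwa [abs_of_pos ht0] at this
  have hD := abs_nonneg (μ₂ - μ₁)
  rcases le_or_gt v (s + m) with hvm | hvm
  · rw [C.avg_right hst.le htv hvm, add_sub_cancel_left]
    have := C.abs_avg_noise_le hr (b := v) (by omega) hvm
    linarith
  -- The segment leaves the window, where the signal is unknown. Its mean is still controlled:
  -- inserting `w` does not pay, so it is close to the mean over `[t, w)`, which lies inside the
  -- window.
  · obtain ⟨w, hw⟩ : ∃ w, w = s + m / 2 := ⟨_, rfl⟩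
    have htw : t < w := by omega
    have hwv : w < v := by omega
    have h1 := (sq_avg_sub_left_le F htw hwv).trans (C.cusumSq_le_of_consec h htw hwv)
    have h2 := C.thresholdSq_le_two_mul (t := t) (w := w) (v := v) (by omega) (by omega)
    have h3 := C.abs_avg_noise_le hr (b := w) (by omega) (by omega)
    have h4 := C.avg_right hst.le htw (by omega)
    have h5 := C.signal
    have h6 : (m : ℝ) ≤ 4 * ((w : ℝ) - t) := by
      have : m ≤ 4 * (w - t) := by omega
      exact_mod_cast this
    have hL := C.hL
    have h7 : L * thresholdSq n q t w v ≤ L * (2 * (q + 2 * Real.log (n / m))) :=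
      mul_le_mul_of_nonneg_left h2 (by linarith)
    have h8 : (avg F t v - avg F t w) ^ 2 * m ≤ (1 / 16 * |μ₂ - μ₁|) ^ 2 * m := by
      have := mul_le_mul_of_nonneg_left h6 (sq_nonneg (avg F t v - avg F t w))
      rw [mul_pow, sq_abs]
      have := mul_nonneg (sq_nonneg (μ₂ - μ₁)) C.m_pos.le
      nlinarith
    have h9 := abs_le_of_sq_le_sq (le_of_mul_le_mul_right h8 C.m_pos) (by positivity)
    rw [h4] at h9
    rw [abs_le] at h3 h9 ⊢
    constructor <;> linarith [h9.1, h9.2, h3.1, h3.2]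

/-- `N` does not have two elements on the same side of `s` close to it. -/
lemma not_consec_near (C : LocalConfig F E N n L q μ₁ μ₂ r s m) {t t' v : ℤ} (h : Consec N t t')
    (h' : Consec N t' v) (hst : s < t) (ht : 64 * (t' - s) < m) : False := by
  have htt := h.2.2.1
  have htv := h'.2.2.1
  have hL := C.hL
  have hq := C.hq
  have hR := C.le_cusumSq_of_consec h h'
  have ht0 := sub_cast_pos htt
  have hv0 := sub_cast_pos htv
  have hlogn : Real.log ((t' : ℝ) - t) ≤ Real.log n :=
    Real.log_le_log ht0 (C.consec_le _ _ h)
  have hlogv : Real.log ((v : ℝ) - t') ≤ Real.log ((v : ℝ) - t) :=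
    Real.log_le_log hv0 (by linarith)
  have hψ : q + 2 * (Real.log n - Real.log ((t' : ℝ) - t)) ≤ thresholdSq n q t t' v := by
    unfold thresholdSq
    linarith
  rcases le_or_gt v (s + m) with hvm | hvm
  -- The signal is constant on the whole triad, so the CUSUM at `t'` is pure noise, at most 4
  -- squared thresholds, while keeping `t'` requires `L ≥ 100` of them.
  · have e : cusumSq F t t' v = cusumSq E t t' v := by
      rw [cusumSq_eq F htt htv, cusumSq_eq E htt htv, C.avg_right hst.le htt (by omega),
        C.avg_right (by omega) htv hvm]
      ring
    have := C.noise t t' v (by omega) htt htv hvm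
    nlinarith
  -- Here `v` is outside the window. The difference of means across `t'` passes through the mean
  -- over `[t', w)`: one part is bounded because inserting `w` does not pay, the other is pure
  -- noise.
  · obtain ⟨w, hw⟩ : ∃ w, w = s + m / 2 := ⟨_, rfl⟩
    have htw : t' < w := by omega
    have hwv : w < v := by omega
    have hw0 := sub_cast_pos htw
    have hwv0 := sub_cast_pos hwv
    have h16 : 16 * ((t' : ℝ) - t) ≤ (w : ℝ) - t' := by
      have : 16 * (t' - t) ≤ w - t' := by omega
      exact_mod_cast this
    have hA := (sq_avg_sub_left_le F htw hwv).trans (C.cusumSq_le_of_consec h' htw hwv)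
    have hN := C.noise t t' w (by omega) htt htw (by omega)
    have e : cusumSq E t t' w = cusumSq F t t' w := by
      rw [cusumSq_eq F htt htw, cusumSq_eq E htt htw, C.avg_right hst.le htt (by omega),
        C.avg_right (by omega) htw (by omega)]
      ring
    have hwv2 : (w : ℝ) - t' ≤ (v : ℝ) - w := by
      have : w - t' ≤ v - w := by omega
      exact_mod_cast this
    -- The gap `t' - t` is much shorter than `w - t'`, so the threshold at `t'` dominates.
    have b1 : thresholdSq n q t' w v ≤ thresholdSq n q t t' v := by
      refine le_trans ?_ hψ
      have e1 : Real.log ((v : ℝ) - t') ≤ Real.log 2 + Real.log ((v : ℝ) - w) := by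
        rw [← Real.log_mul two_ne_zero hwv0.ne']
        exact Real.log_le_log hv0 (by linarith)
      have e2 : Real.log 2 + Real.log ((t' : ℝ) - t) ≤ Real.log ((w : ℝ) - t') := by
        rw [← Real.log_mul two_ne_zero ht0.ne']
        exact Real.log_le_log (by positivity) (by linarith)
      unfold thresholdSq
      linarith
    have b2 : thresholdSq n q t t' w ≤ 2 * thresholdSq n q t t' v := by
      have e1 : Real.log ((w : ℝ) - t) ≤ (1 : ℕ) * 0.7 + Real.log ((w : ℝ) - t') :=
        log_le_of_le_two_pow_mul 1 (by linarith) hw0 (by linarith)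
      have : thresholdSq n q t t' w ≤ q + 2 * (Real.log n - Real.log ((t' : ℝ) - t)) + 1.4 := by
        unfold thresholdSq
        push_cast at e1
        linarith
      linarith
    have c1 : (avg F t' v - avg F t' w) ^ 2 * ((t' : ℝ) - t) ≤
        L * thresholdSq n q t t' v / 16 := by
      have := mul_le_mul_of_nonneg_left h16 (sq_nonneg (avg F t' v - avg F t' w))
      have : L * thresholdSq n q t' w v ≤ L * thresholdSq n q t t' v :=
        mul_le_mul_of_nonneg_left b1 (by linarith)
      linarith
    have c2 : (avg F t' w - avg F t t') ^ 2 * ((t' : ℝ) - t) ≤ 16 * thresholdSq n q t t' v := by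
      rw [e, cusumSq_eq F htt htw] at hN
      have hweight : ((t' : ℝ) - t) / 2 ≤
          ((t' : ℝ) - t) * ((w : ℝ) - t') / ((w : ℝ) - t) := by
        rw [div_le_div_iff₀ (by norm_num) (by linarith)]
        nlinarith
      have := mul_le_mul_of_nonneg_left hweight (sq_nonneg (avg F t' w - avg F t t'))
      linarith
    have c3 := hR.trans (cusumSq_le_left F htt htv)
    -- With `c1` and `c2`, the CUSUM at `t'` is at most `L / 8 + 32` squared thresholds, less than
    -- the required `L`.
    have c4 : (avg F t' v - avg F t t') ^ 2 ≤
        2 * (avg F t' v - avg F t' w) ^ 2 + 2 * (avg F t' w - avg F t t') ^ 2 := by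
      nlinarith [sq_nonneg ((avg F t' v - avg F t' w) - (avg F t' w - avg F t t'))]
    have c5 := mul_le_mul_of_nonneg_right c4 ht0.le
    have : 0 < thresholdSq n q t t' v := by linarith
    nlinarith

/-- An empty piece costs `0`, because division by zero makes both its terms vanish; this lets an
auxiliary node coincide with an endpoint. The constant `5.6` is `8 * 0.7`, from `256 = 2 ^ 8`. -/
lemma segCost_le (C : LocalConfig F E N n L q μ₁ μ₂ r s m) {a b : ℤ} (hab : a ≤ b)
    (h : a = b ∨ m ≤ 256 * (b - a)) :
    segCost F n L a b ≤
      -explained F a b + 2 * L * (5.6 + (Real.log n - Real.log m)) := by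
  have hL := C.hL
  have hlog := C.log_ratio_nonneg
  have hm := C.one_le
  rcases hab.eq_or_lt with rfl | hab
  · have : 0 ≤ 2 * L * (5.6 + (Real.log n - Real.log m)) := by positivity
    simpa [segCost, explained] using this
  · have h1 : m ≤ 256 * (b - a) := by omega
    have h1' : (m : ℝ) ≤ 256 * ((b : ℝ) - a) := by exact_mod_cast h1
    have e := log_le_of_le_two_pow_mul 8 C.m_pos (sub_cast_pos hab) (by linarith)
    push_cast at e
    rw [segCost_eq F L C.n_pos hab]
    have : 2 * L * (Real.log n - Real.log ((b : ℝ) - a)) ≤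
        2 * L * (5.6 + (Real.log n - Real.log m)) :=
      mul_le_mul_of_nonneg_left (by linarith) (by linarith)
    linarith

/-- `N` has an element close to `s`. -/
lemma exists_near (C : LocalConfig F E N n L q μ₁ μ₂ r s m) :
    ∃ p ∈ N, 256 * |p - s| < m := by
  by_contra! hfar
  obtain ⟨u, v, huv, hus, hsv⟩ := C.bracket
  have hm := C.one_le
  have hu := hfar u huv.1
  have hv := hfar v huv.2.1
  rw [abs_of_neg (by omega)] at hu
  rw [abs_of_pos (by omega)] at hv
  -- The node `l` must stay in the window, at distance of order `m` from `s`, and leave a piece `[u,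
  -- l)` that is empty or not short. Rounding `m / 2` up keeps `l ≠ s` when `m = 1`.
  obtain ⟨l, hul, hls, hlm, hlm', hl⟩ : ∃ l, u ≤ l ∧ l < s ∧ m ≤ 256 * (s - l) ∧ s - m ≤ l ∧
      (u = l ∨ m ≤ 256 * (l - u)) := by
    rcases le_or_gt (s - u) m with h | h
    · exact ⟨u, by omega, by omega, by omega, by omega, by omega⟩
    · exact ⟨s - (m + 1) / 2, by omega, by omega, by omega, by omega, by omega⟩
  obtain ⟨w, hwv, hsw, hwm, hwm', hw⟩ : ∃ w, w ≤ v ∧ s < w ∧ m ≤ 256 * (w - s) ∧ w ≤ s + m ∧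
      (w = v ∨ m ≤ 256 * (v - w)) := by
    rcases le_or_gt (v - s) m with h | h
    · exact ⟨v, by omega, by omega, by omega, by omega, by omega⟩
    · exact ⟨s + (m + 1) / 2, by omega, by omega, by omega, by omega, by omega⟩
  have hL := C.hL
  have hq := C.hq
  have hlog := C.log_ratio_nonneg
  have hsig := C.signal
  rw [C.log_ratio] at hsig
  have hO := C.ins₃ u v l s w huv hul hls hsw hwv
  have k1 := C.segCost_le hul hl
  have k2 := C.segCost_le hls.le (Or.inr hlm)
  have k3 := C.segCost_le hsw.le (Or.inr hwm)
  have k4 := C.segCost_le hwv hw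
  have k5 : -explained F u v ≤ segCost F n L u v := by
    have := C.consec_le u v huv
    have huv0 := sub_cast_pos huv.2.2.1
    have : 0 ≤ Real.log (n / ((v : ℝ) - u)) := Real.log_nonneg ((one_le_div huv0).2 this)
    have : 0 ≤ 2 * L * Real.log (n / ((v : ℝ) - u)) := by positivity
    unfold segCost
    linarith
  have k6 := explained_le_add F hul (by omega : l ≤ v)
  have k7 := explained_le_add F (by omega : l ≤ w) hwv
  obtain ⟨lam, hlam⟩ : ∃ lam, lam = Real.log n - Real.log m := ⟨_, rfl⟩
  rw [← hlam] at hlog hsig k1 k2 k3 k4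
  -- Three insertions pay at most this much penalty, while the jump has CUSUM of order `10 ^ 6 /
  -- 512` times `L * (q + 2 * lam)`.
  have kF : cusumSq F l s w ≤ 12 * (L * (q + 2 * lam)) := by
    unfold cusumSq
    nlinarith
  have hx := sub_cast_pos hls
  have hy := sub_cast_pos hsw
  have hlmR : (m : ℝ) ≤ 256 * ((s : ℝ) - l) := by exact_mod_cast hlm
  have hwmR : (m : ℝ) ≤ 256 * ((w : ℝ) - s) := by exact_mod_cast hwm
  have hprod : (m : ℝ) * ((w : ℝ) - l) ≤ 2 ^ 9 * (((w : ℝ) - s) * ((s : ℝ) - l)) := by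
    nlinarith
  have hwl : (0 : ℝ) < (w : ℝ) - l := by linarith
  have kE : cusumSq E l s w ≤ 16 * (q + 2 * lam) := by
    have h1 := C.noise l s w hlm' hls hsw hwm'
    have h2 := log_le_of_le_two_pow_mul 9 (mul_pos C.m_pos hwl) (mul_pos hy hx) hprod
    rw [Real.log_mul C.m_pos.ne' hwl.ne', Real.log_mul hy.ne' hx.ne'] at h2
    push_cast at h2
    unfold thresholdSq at h1
    linarith
  have hweight : (m : ℝ) / 512 ≤ ((s : ℝ) - l) * ((w : ℝ) - s) / ((w : ℝ) - l) := by
    rw [div_le_div_iff₀ (by norm_num) hwl]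
    linarith
  rw [cusumSq_eq F hls hsw, C.avg_left hlm' hls le_rfl, C.avg_right le_rfl hsw hwm'] at kF
  rw [cusumSq_eq E hls hsw] at kE
  generalize ((s : ℝ) - l) * ((w : ℝ) - s) / ((w : ℝ) - l) = ω at *
  generalize avg E s w = e₂ at *
  generalize avg E l s = e₁ at *
  have hω : 0 ≤ ω := by
    have := C.m_pos
    exact le_trans (by positivity) hweight
  have hsq : (μ₂ - μ₁) ^ 2 ≤ 2 * (μ₂ + e₂ - (μ₁ + e₁)) ^ 2 + 2 * (e₂ - e₁) ^ 2 := by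
    nlinarith [sq_nonneg ((μ₂ + e₂ - (μ₁ + e₁)) + (e₂ - e₁))]
  have h1 := mul_le_mul_of_nonneg_right hsq hω
  have h2 := mul_le_mul_of_nonneg_left hweight (sq_nonneg (μ₂ - μ₁))
  have h3 : 0 < q + 2 * lam := by linarith
  nlinarith

lemma abs_avg_sub_le' (C : LocalConfig F E N n L q μ₁ μ₂ r s m) {u' u : ℤ} (h : Consec N u' u)
    (hus : u < s) (hu : 256 * (s - u) < m) (hu' : m ≤ 64 * (s - u')) :
    |avg F u' u - μ₁| ≤ 3 / 16 * |μ₂ - μ₁| := by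
  have := C.reflect.abs_avg_sub_le h.reflect' (by omega) (by omega) (by omega)
  rwa [avg_reflect, neg_neg, neg_neg, abs_sub_comm μ₁] at this

lemma abs_avg_noise_self_le' (C : LocalConfig F E N n L q μ₁ μ₂ r s m) {a : ℤ}
    (has : a < s) (hr : r ≤ (s : ℝ) - a) (ha : s - m ≤ a) :
    |avg E a s| ≤ 1 / 16 * |μ₂ - μ₁| := by
  have := C.reflect.abs_avg_noise_self_le (b := -a) (by omega) (by push_cast; linarith) (by omega)
  rwa [avg_reflect, neg_neg, neg_neg, abs_sub_comm μ₁] at this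

lemma not_consec_near' (C : LocalConfig F E N n L q μ₁ μ₂ r s m) {u'' u' u : ℤ}
    (h : Consec N u'' u') (h' : Consec N u' u) (hus : u < s) (hu : 64 * (s - u') < m) : False :=
  C.reflect.not_consec_near h'.reflect' h.reflect' (by omega) (by omega)

lemma sq_le_of_abs_le {x c y : ℝ} (h : |x| ≤ c * |y|) : x ^ 2 ≤ c ^ 2 * y ^ 2 := by
  rw [← sq_abs x, ← sq_abs y, ← mul_pow]
  exact pow_le_pow_left₀ (abs_nonneg _) h 2

/-- Splitting at `s` the segment `[u, t)` that contains it reduces the residuals by a fixed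
fraction of the energy of the jump over `[s, t)`. -/
lemma le_cusumSq_of_near (C : LocalConfig F E N n L q μ₁ μ₂ r s m) {u t : ℤ} (h : Consec N u t)
    (hus : u < s) (hst : s < t) (ht : 256 * (t - s) < m) (hle : t - s ≤ s - u)
    (hr : r ≤ (t : ℝ) - s) :
    ((t : ℝ) - s) * (μ₂ - μ₁) ^ 2 / 8 ≤ cusumSq F u s t := by
  have ht0 := sub_cast_pos hst
  have hu0 := sub_cast_pos hus
  have hleR : (t : ℝ) - s ≤ (s : ℝ) - u := by exact_mod_cast hle
  have hX := C.abs_avg_noise_self_le hst hr (by omega)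
  have hD := abs_nonneg (μ₂ - μ₁)
  have hDs := sq_abs (μ₂ - μ₁)
  -- The mean over `[s, t)` is close to `μ₂`, so it is far from any `y` close to `μ₁`. This is
  -- applied to the mean over `[u, s)` if `u` is in the window, and over `[u, t)` otherwise.
  have hsq : ∀ y : ℝ, 1 / 16 * |μ₂ - μ₁| + |y - μ₁| ≤ 1 / 4 * |μ₂ - μ₁| →
      9 / 16 * (μ₂ - μ₁) ^ 2 ≤ (avg F s t - y) ^ 2 := by
    intro y hy
    have h1 : 3 / 4 * |μ₂ - μ₁| ≤ |avg F s t - y| := by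
      rw [C.avg_right le_rfl hst (by omega)]
      have e : μ₂ - μ₁ = (μ₂ + avg E s t - y) - avg E s t + (y - μ₁) := by ring
      have : |μ₂ - μ₁| ≤ |μ₂ + avg E s t - y| + |avg E s t| + |y - μ₁| := by
        conv_lhs => rw [e]
        exact (abs_add_le _ _).trans (add_le_add_left (abs_sub _ _) _)
      linarith
    have h2 := pow_le_pow_left₀ (by positivity) h1 2
    rw [sq_abs, mul_pow, sq_abs] at h2
    linarith
  rcases le_or_gt (s - m) u with hum | hum
  · have hA := C.abs_avg_noise_self_le' hus (by linarith) hum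
    rw [cusumSq_eq F hus hst]
    have h1 := hsq (avg F u s) (by
      rw [C.avg_left hum hus le_rfl, add_sub_cancel_left]
      linarith)
    have hweight : ((t : ℝ) - s) / 2 ≤ ((s : ℝ) - u) * ((t : ℝ) - s) / ((t : ℝ) - u) := by
      rw [div_le_div_iff₀ (by norm_num) (by linarith)]
      nlinarith
    calc ((t : ℝ) - s) * (μ₂ - μ₁) ^ 2 / 8 ≤ 9 / 16 * (μ₂ - μ₁) ^ 2 * (((t : ℝ) - s) / 2) := by
          have := mul_nonneg ht0.le (sq_nonneg (μ₂ - μ₁))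
          linarith
      _ ≤ _ := mul_le_mul h1 hweight (by positivity) (sq_nonneg _)
  -- Inserting `w` does not pay, so the mean over `[u, t)` is close to that over `[w, t)`, and the
  -- latter is close to `μ₁` because `[s, t)` is a small fraction of `[w, t)`.
  · obtain ⟨w, hw⟩ : ∃ w, w = s - m / 4 := ⟨_, rfl⟩
    have huw : u < w := by omega
    have hws : w < s := by omega
    have hwt : w < t := by omega
    have hwt0 := sub_cast_pos hwt
    have hws0 := sub_cast_pos hws
    have hL := C.hL
    have h1 := (sq_avg_sub_right_le F huw hwt).trans (C.cusumSq_le_of_consec h huw hwt)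
    have h2 := C.thresholdSq_le_two_mul (t := -t) (w := -w) (v := -u) (by omega) (by omega)
    rw [← thresholdSq_reflect] at h2
    have h5 := C.signal
    have h6 : (m : ℝ) ≤ 4 * ((t : ℝ) - w) := by
      have : m ≤ 4 * (t - w) := by omega
      exact_mod_cast this
    have h7 : L * thresholdSq n q u w t ≤ L * (2 * (q + 2 * Real.log (n / m))) :=
      mul_le_mul_of_nonneg_left h2 (by linarith)
    have h8 : (avg F w t - avg F u t) ^ 2 * m ≤ (1 / 16 * |μ₂ - μ₁|) ^ 2 * m := by
      have := mul_le_mul_of_nonneg_left h6 (sq_nonneg (avg F w t - avg F u t))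
      rw [mul_pow, sq_abs]
      have := mul_nonneg (sq_nonneg (μ₂ - μ₁)) C.m_pos.le
      nlinarith
    have h9 := abs_le_of_sq_le_sq (le_of_mul_le_mul_right h8 C.m_pos) (by positivity)
    have h10 : |avg F w t - μ₁| ≤ 3 / 32 * |μ₂ - μ₁| := by
      have f1 := C.left w (by omega) hws.le
      have f2 := C.right t hst.le (by omega)
      have d1 := C.dev w (by omega) (by omega) (by
        rw [abs_sub_comm, abs_of_pos hws0]
        have : t - s ≤ s - w := by omega
        have : (t : ℝ) - s ≤ (s : ℝ) - w := by exact_mod_cast this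
        linarith)
      have d2 := C.dev t (by omega) (by omega) (by rwa [abs_of_pos ht0])
      rw [abs_sub_comm (w : ℝ), abs_of_pos hws0] at d1
      rw [abs_of_pos ht0] at d2
      have e : avg F w t - μ₁ =
          ((μ₂ - μ₁) * ((t : ℝ) - s) + (E t - E s) - (E w - E s)) / ((t : ℝ) - w) := by
        unfold avg
        rw [eq_div_iff hwt0.ne', sub_mul, div_mul_cancel₀ _ hwt0.ne']
        linarith
      rw [e, abs_div, abs_of_pos hwt0, div_le_iff₀ hwt0]
      have t1 := abs_sub ((μ₂ - μ₁) * ((t : ℝ) - s) + (E t - E s)) (E w - E s)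
      have t2 := abs_add_le ((μ₂ - μ₁) * ((t : ℝ) - s)) (E t - E s)
      rw [abs_mul, abs_of_pos ht0] at t2
      have h32 : 32 * ((t : ℝ) - s) ≤ (t : ℝ) - w := by
        have : 32 * (t - s) ≤ t - w := by omega
        exact_mod_cast this
      have := mul_le_mul_of_nonneg_left h32 hD
      nlinarith
    have h11 : |avg F u t - μ₁| ≤ 3 / 16 * |μ₂ - μ₁| := by
      rw [abs_le] at h9 h10 ⊢
      constructor <;> linarith [h9.1, h9.2, h10.1, h10.2]
    have h12 := hsq (avg F u t) (by linarith)
    refine le_trans ?_ (sq_avg_sub_right_le F hus hst)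
    have h13 := mul_le_mul_of_nonneg_right h12 ht0.le
    have := mul_nonneg ht0.le (sq_nonneg (μ₂ - μ₁))
    linarith

/-- Moving `t` to `s` first forces `u` to be close to `s`; replacing both `u` and `t` by `s` then
contradicts optimality. -/
lemma false_of_nearest_right (C : LocalConfig F E N n L q μ₁ μ₂ r s m) {u t : ℤ}
    (h : Consec N u t) (hus : u < s) (hst : s < t) (ht : 256 * (t - s) < m)
    (hle : t - s ≤ s - u) : False := by
  have ht0 := sub_cast_pos hst
  have hu0 := sub_cast_pos hus
  have hleR : (t : ℝ) - s ≤ (s : ℝ) - u := by exact_mod_cast hle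
  have hL := C.hL
  have hq := C.hq
  have hn := C.n_pos
  have hD := abs_nonneg (μ₂ - μ₁)
  have hr : r ≤ (t : ℝ) - s := by
    have := C.far t h.2.1 (by
      rw [abs_of_pos ht0]
      have : t - s < m := by omega
      exact_mod_cast this)
    rwa [abs_of_pos ht0] at this
  obtain ⟨v, hv⟩ := C.next t h.2.1 (by omega)
  have htv := hv.2.2.1
  have hv0 := sub_cast_pos htv
  -- If `v` were near, it would not be the last node, and `t`, `v` would be two near nodes on the
  -- same side.
  have hvs : m ≤ 64 * (v - s) := by
    by_contra! hlt
    obtain ⟨v', hv'⟩ := C.next v hv.2.1 (by omega)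
    exact C.not_consec_near hv hv' hst hlt
  have hB := C.abs_avg_sub_le hv hst ht hvs
  have hX := C.abs_avg_noise_self_le hst hr (by omega)
  have hR : cusumSq F s t v ≤ ((t : ℝ) - s) * (μ₂ - μ₁) ^ 2 / 16 := by
    have h1 : |avg F t v - avg F s t| ≤ 1 / 4 * |μ₂ - μ₁| := by
      rw [C.avg_right le_rfl hst (by omega)]
      rw [abs_le] at hB hX ⊢
      constructor <;> linarith [hB.1, hB.2, hX.1, hX.2]
    have h2 := mul_le_mul_of_nonneg_right (sq_le_of_abs_le h1) ht0.le
    have h3 := cusumSq_le_left F hst htv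
    linarith
  have hG := C.le_cusumSq_of_near h hus hst ht hle hr
  have hvt : Real.log ((v : ℝ) - t) ≤ Real.log ((v : ℝ) - s) := Real.log_le_log hv0 (by linarith)
  -- The move gains `1 / 8` in `hG` and loses `1 / 16` in `hR`, in units of `(t - s) * (μ₂ - μ₁) ^
  -- 2`. The penalty changes by logarithms of length ratios only, and `log (1 + z) ≤ z` makes both
  -- sides proportional to `t - s`.
  have hM : (μ₂ - μ₁) ^ 2 * ((s : ℝ) - u) ≤ 32 * L := by
    have h1 := C.move u t v s h hv hus (hst.trans htv)
    rw [segCost_eq F L hn h.2.2.1, segCost_eq F L hn htv, segCost_eq F L hn hus,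
      segCost_eq F L hn (hst.trans htv)] at h1
    have h2 : Real.log ((t : ℝ) - u) - Real.log ((s : ℝ) - u) ≤
        ((t : ℝ) - s) / ((s : ℝ) - u) := by
      rw [← Real.log_div (by linarith) hu0.ne']
      refine (Real.log_le_sub_one_of_pos (by apply div_pos <;> linarith)).trans (le_of_eq ?_)
      field_simp
      ring
    have h3 : 2 * L * (Real.log ((t : ℝ) - u) - Real.log ((s : ℝ) - u)) ≤
        2 * L * (((t : ℝ) - s) / ((s : ℝ) - u)) :=
      mul_le_mul_of_nonneg_left h2 (by linarith)
    have h4 : 2 * L * Real.log ((v : ℝ) - t) ≤ 2 * L * Real.log ((v : ℝ) - s) :=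
      mul_le_mul_of_nonneg_left hvt (by linarith)
    have h5 : ((t : ℝ) - s) * (μ₂ - μ₁) ^ 2 / 16 ≤ 2 * L * (((t : ℝ) - s) / ((s : ℝ) - u)) := by
      unfold cusumSq at hR hG
      linarith
    have h6 := mul_le_mul_of_nonneg_right h5 hu0.le
    rw [mul_assoc, div_mul_cancel₀ _ hu0.ne'] at h6
    have h7 : ((t : ℝ) - s) * ((μ₂ - μ₁) ^ 2 * ((s : ℝ) - u)) ≤ ((t : ℝ) - s) * (32 * L) := by
      linarith
    exact le_of_mul_le_mul_left h7 ht0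
  have hlog := C.log_ratio_nonneg
  have hsig := C.signal
  rw [C.log_ratio] at hsig
  have hD0 : 0 < (μ₂ - μ₁) ^ 2 := by
    have : 0 < (μ₂ - μ₁) ^ 2 * m := lt_of_lt_of_le (by positivity) hsig
    exact pos_of_mul_pos_left this C.m_pos.le
  -- By `hM` and the size of the signal, `u` is near on the scale `m`, so its own left neighbour is
  -- far and the mirror images of the preceding bounds apply.
  have hu : 256 * (s - u) < m := by
    have h1 : (μ₂ - μ₁) ^ 2 * (256 * ((s : ℝ) - u)) < (μ₂ - μ₁) ^ 2 * m := by
      nlinarith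
    have := lt_of_mul_lt_mul_left h1 hD0.le
    exact_mod_cast this
  obtain ⟨u', hu'⟩ := C.prev u h.1 (by omega)
  have hu'u := hu'.2.2.1
  have hu'0 := sub_cast_pos hu'u
  have hu's : m ≤ 64 * (s - u') := by
    by_contra! hlt
    obtain ⟨u'', hu''⟩ := C.prev u' hu'.1 (by omega)
    exact C.not_consec_near' hu'' hu' hus hlt
  have hB' := C.abs_avg_sub_le' hu' hus hu hu's
  have hX' := C.abs_avg_noise_self_le' hus (by linarith) (by omega)
  have hR' : cusumSq F u' u s ≤ ((s : ℝ) - u) * (μ₂ - μ₁) ^ 2 / 16 := by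
    have h1 : |avg F u s - avg F u' u| ≤ 1 / 4 * |μ₂ - μ₁| := by
      rw [C.avg_left (by omega) hus le_rfl]
      rw [abs_le] at hB' hX' ⊢
      constructor <;> linarith [hB'.1, hB'.2, hX'.1, hX'.2]
    have h2 := mul_le_mul_of_nonneg_right (sq_le_of_abs_le h1) hu0.le
    have h3 := cusumSq_le_right F hu'u hus
    linarith
  -- Replacing `u` and `t` by `s` saves `L * q`, and the logarithms change favourably (`hlog3`). The
  -- loss is at most the sum of `hR` and `hR'`, since splitting `[u, t)` at `s` only helps the fit.
  have hmerge := C.merge u' u t v s hu' h hv (hu'u.trans hus) (hst.trans htv)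
  rw [segCost_eq F L hn h.2.2.1, segCost_eq F L hn htv, segCost_eq F L hn hu'u,
    segCost_eq F L hn (hst.trans htv), segCost_eq F L hn (hu'u.trans hus)] at hmerge
  have hlog1 : Real.log ((u : ℝ) - u') ≤ Real.log ((s : ℝ) - u') :=
    Real.log_le_log hu'0 (by linarith)
  have hlog2 : Real.log ((t : ℝ) - u) ≤ Real.log n :=
    Real.log_le_log (by linarith) (C.consec_le _ _ h)
  have hlog3 : 0 ≤ 2 * L * ((Real.log n - Real.log ((t : ℝ) - u)) +
      (Real.log ((s : ℝ) - u') - Real.log ((u : ℝ) - u')) +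
      (Real.log ((v : ℝ) - s) - Real.log ((v : ℝ) - t))) :=
    mul_nonneg (by linarith) (by linarith)
  have hpos := cusumSq_nonneg F hus hst
  have hfin : L * q ≤ 4 * L := by
    have : ((t : ℝ) - s) * (μ₂ - μ₁) ^ 2 ≤ ((s : ℝ) - u) * (μ₂ - μ₁) ^ 2 :=
      mul_le_mul_of_nonneg_right hleR hD0.le
    unfold cusumSq at hR hR' hpos
    linarith
  nlinarith

/-- A segmentation that no local change improves has a node at distance less than `r` from `s`:
the field `far`, which denies it, is refuted by the others. -/
theorem elim (C : LocalConfig F E N n L q μ₁ μ₂ r s m) : False := by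
  obtain ⟨p, hp, hpm⟩ := C.exists_near
  obtain ⟨u, t, h, hus, hst⟩ := C.bracket
  have hside := h.2.2.2 p hp
  have : 256 * (t - s) < m ∨ 256 * (s - u) < m := by
    rcases hside with h1 | h1
    · rw [abs_of_neg (by omega)] at hpm
      omega
    · rw [abs_of_pos (by omega)] at hpm
      omega
  -- One neighbour of `s` is near by `exists_near`, hence so is the nearer one; reflection puts it
  -- on the right.
  rcases le_total (t - s) (s - u) with hle | hle
  · exact C.false_of_nearest_right h hus hst (by omega) hle
  · exact C.reflect.false_of_nearest_right h.reflect' (by omega) (by omega) (by omega) (by omega)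

end LocalConfig

/-! ### The criterion as a sum of segment costs. -/

/-- The sum of the coordinates of `f` at the times before `p`. -/
def psum {n : ℕ} (f : Fin n → ℝ) (p : ℤ) : ℝ := ∑ i : Fin n, if (i : ℤ) + 1 < p then f i else 0

section psum

variable {n : ℕ}

lemma psum_sub (f : Fin n → ℝ) {a b : ℤ} (hab : a ≤ b) :
    psum f b - psum f a = ∑ i : Fin n, if a ≤ (i : ℤ) + 1 ∧ (i : ℤ) + 1 < b then f i else 0 := by
  unfold psum
  rw [← Finset.sum_sub_distrib]
  refine Finset.sum_congr rfl fun i _ => ?_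
  split_ifs <;> first | (exfalso; omega) | simp

lemma psum_sub_congr {f g : Fin n → ℝ} {a b : ℤ} (hab : a ≤ b)
    (h : ∀ i : Fin n, a ≤ (i : ℤ) + 1 → (i : ℤ) + 1 < b → f i = g i) :
    psum f b - psum f a = psum g b - psum g a := by
  rw [psum_sub f hab, psum_sub g hab]
  refine Finset.sum_congr rfl fun i _ => ?_
  split_ifs with hi
  · exact h i hi.1 hi.2
  · rfl

lemma psum_add (f g : Fin n → ℝ) (p : ℤ) : psum (fun i => f i + g i) p = psum f p + psum g p := by
  unfold psum
  rw [← Finset.sum_add_distrib]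
  refine Finset.sum_congr rfl fun i _ => ?_
  split_ifs <;> simp

lemma psum_const_mul (c : ℝ) (f : Fin n → ℝ) (p : ℤ) :
    psum (fun i => c * f i) p = c * psum f p := by
  unfold psum
  rw [Finset.mul_sum]
  refine Finset.sum_congr rfl fun i _ => ?_
  split_ifs <;> simp

lemma psum_one (f : Fin n → ℝ) : psum f 1 = 0 :=
  Finset.sum_eq_zero fun i _ => if_neg (by omega)

lemma psum_last (f : Fin n → ℝ) : psum f ((n : ℤ) + 1) = ∑ i, f i :=
  Finset.sum_congr rfl fun i _ => if_pos (by omega)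

lemma psum_ones {p : ℤ} (h1 : 1 ≤ p) (h2 : p ≤ (n : ℤ) + 1) :
    psum (fun _ : Fin n => (1 : ℝ)) p = (p : ℝ) - 1 := by
  obtain ⟨k, hk⟩ : ∃ k : ℕ, p = (k : ℤ) + 1 := ⟨(p - 1).toNat, by omega⟩
  subst hk
  have hkn : k ≤ n := by omega
  have : ∀ i : Fin n, ((i : ℤ) + 1 < (k : ℤ) + 1) ↔ (i : ℕ) < k := fun i => by omega
  unfold psum
  simp only [this]
  rw [Finset.sum_boole, Fin.card_filter_val_lt]
  simp [hkn]

lemma psum_sub_const (c : ℝ) {a b : ℤ} (ha : 1 ≤ a) (hab : a ≤ b) (hb : b ≤ (n : ℤ) + 1) :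
    psum (fun _ : Fin n => c) b - psum (fun _ : Fin n => c) a = c * ((b : ℝ) - a) := by
  have h1 := psum_const_mul c (fun _ : Fin n => (1 : ℝ)) a
  have h2 := psum_const_mul c (fun _ : Fin n => (1 : ℝ)) b
  rw [psum_ones (by omega) (by omega)] at h1 h2
  simp only [mul_one] at h1 h2
  rw [h1, h2]
  ring

lemma segMean_eq_avg (y : EuclideanSpace ℝ (Fin n)) {a b : ℕ} (hab : a ≤ b) :
    segMean y a b = avg (psum fun i => y i) a b := by
  unfold segMean avg
  rw [psum_sub _ (by exact_mod_cast hab)]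
  norm_cast

/-- The residual sum of squares of a constant over a segment. -/
lemma psum_sq_sub (Y : Fin n → ℝ) (c : ℝ) {a b : ℤ} (ha : 1 ≤ a) (hab : a < b)
    (hb : b ≤ (n : ℤ) + 1) :
    psum (fun i => (Y i - c) ^ 2) b - psum (fun i => (Y i - c) ^ 2) a =
      (psum (fun i => Y i ^ 2) b - psum (fun i => Y i ^ 2) a) - explained (psum Y) a b +
        ((b : ℝ) - a) * (c - avg (psum Y) a b) ^ 2 := by
  have e : (fun i => (Y i - c) ^ 2) = fun i => Y i ^ 2 + ((-2 * c) * Y i + c ^ 2) := by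
    funext i
    ring
  have h := psum_sub_const (n := n) (c ^ 2) ha hab.le hb
  have hpos := (sub_cast_pos hab).ne'
  rw [e]
  simp only [psum_add, psum_const_mul]
  unfold explained avg
  generalize psum Y b = B at *
  generalize psum Y a = A at *
  have e2 : ((b : ℝ) - a) * (c - (B - A) / ((b : ℝ) - a)) ^ 2 =
      c ^ 2 * ((b : ℝ) - a) - 2 * c * (B - A) + (B - A) ^ 2 / ((b : ℝ) - a) := by
    field_simp
    ring
  rw [e2]
  linarith

end psum

lemma sum_succ_sub_castSucc (k : ℕ) (G : Fin (k + 2) → ℝ) :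
    ∑ j : Fin (k + 1), (G j.succ - G j.castSucc) = G (Fin.last (k + 1)) - G 0 := by
  induction k with
  | zero => simp
  | succ k ih =>
    rw [Fin.sum_univ_castSucc]
    have := ih fun j => G j.castSucc
    simp only [← Fin.succ_castSucc] at this
    rw [this]
    simp

namespace CPVector

variable {n : ℕ} (τ : CPVector n)

lemma one_le_pt (j : Fin (τ.len + 2)) : 1 ≤ τ.pt j := by
  rw [← τ.pt_zero]
  exact τ.strictMono.monotone (Fin.zero_le j)

lemma pt_le (j : Fin (τ.len + 2)) : τ.pt j ≤ n + 1 := by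
  rw [← τ.pt_last]
  exact τ.strictMono.monotone (Fin.le_last j)

lemma pt_lt (j : Fin (τ.len + 1)) : τ.pt j.castSucc < τ.pt j.succ :=
  τ.strictMono j.castSucc_lt_succ

lemma sum_eq_sum_segments (f : Fin n → ℝ) :
    ∑ i, f i = ∑ j : Fin (τ.len + 1), (psum f (τ.pt j.succ) - psum f (τ.pt j.castSucc)) := by
  rw [sum_succ_sub_castSucc τ.len fun j => psum f (τ.pt j), τ.pt_zero, τ.pt_last]
  push_cast
  rw [psum_last, psum_one, sub_zero]

/-- On each segment, the residual of a constant is the residual of the segment mean plus a squared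
deviation. Keeping that deviation explicit serves both inequalities for the projection. -/
lemma norm_sub_sq (Y w : EuclideanSpace ℝ (Fin n)) (c : Fin (τ.len + 1) → ℝ)
    (hw : ∀ j i, τ.InSegment j i → w i = c j) :
    ‖Y - w‖ ^ 2 = ‖Y‖ ^ 2 -
        ∑ j : Fin (τ.len + 1), explained (psum fun i => Y i) (τ.pt j.castSucc) (τ.pt j.succ) +
      ∑ j : Fin (τ.len + 1), ((τ.pt j.succ : ℝ) - τ.pt j.castSucc) *
        (c j - avg (psum fun i => Y i) (τ.pt j.castSucc) (τ.pt j.succ)) ^ 2 := by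
  rw [EuclideanSpace.real_norm_sq_eq, EuclideanSpace.real_norm_sq_eq, τ.sum_eq_sum_segments,
    τ.sum_eq_sum_segments fun i => Y i ^ 2, ← Finset.sum_sub_distrib, ← Finset.sum_add_distrib]
  refine Finset.sum_congr rfl fun j _ => ?_
  have h1 := τ.one_le_pt j.castSucc
  have h2 := τ.pt_lt j
  have h3 := τ.pt_le j.succ
  rw [psum_sub_congr (g := fun i => (Y i - c j) ^ 2) (by exact_mod_cast h2.le),
    psum_sq_sub _ _ (by exact_mod_cast h1) (by exact_mod_cast h2) (by exact_mod_cast h3)]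
  · simp
  · intro i hi1 hi2
    rw [← hw j i ⟨by omega, by omega⟩]
    rfl

lemma inSegment_unique {j j' : Fin (τ.len + 1)} {i : Fin n} (h : τ.InSegment j i)
    (h' : τ.InSegment j' i) : j = j' := by
  by_contra hne
  rcases lt_or_gt_of_ne hne with hlt | hlt
  · have := τ.strictMono.monotone (Fin.succ_le_castSucc_iff.2 hlt)
    unfold InSegment at h h'
    omega
  · have := τ.strictMono.monotone (Fin.succ_le_castSucc_iff.2 hlt)
    unfold InSegment at h h'
    omega

/-- The projection does at least as well as the vector of segment means; conversely it is itself
constant on segments, so its residual exceeds that of the means by a nonnegative sum. -/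
lemma norm_sub_starProjection_sq (Y : EuclideanSpace ℝ (Fin n)) :
    ‖Y - τ.pieceSpace.starProjection Y‖ ^ 2 = ‖Y‖ ^ 2 -
      ∑ j : Fin (τ.len + 1), explained (psum fun i => Y i) (τ.pt j.castSucc) (τ.pt j.succ) := by
  apply le_antisymm
  · classical
    let c : Fin (τ.len + 1) → ℝ := fun j =>
      avg (psum fun i => Y i) (τ.pt j.castSucc) (τ.pt j.succ)
    let w : EuclideanSpace ℝ (Fin n) := WithLp.toLp 2 fun i =>
      if h : ∃ j, τ.InSegment j i then c h.choose else 0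
    have hw : ∀ j i, τ.InSegment j i → w i = c j := by
      intro j i hij
      have h : ∃ j, τ.InSegment j i := ⟨j, hij⟩
      change (if h : ∃ j, τ.InSegment j i then c h.choose else 0) = c j
      rw [dif_pos h, τ.inSegment_unique h.choose_spec hij]
    have hmem : w ∈ τ.pieceSpace := fun j i i' h h' => by rw [hw j i h, hw j i' h']
    have h1 : ‖Y - τ.pieceSpace.starProjection Y‖ ≤ ‖Y - w‖ := by
      rw [Submodule.starProjection_minimal]
      exact ciInf_le ⟨0, Set.forall_mem_range.mpr fun _ => norm_nonneg _⟩
        (⟨w, hmem⟩ : τ.pieceSpace)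
    refine (pow_le_pow_left₀ (norm_nonneg _) h1 2).trans (le_of_eq ?_)
    rw [τ.norm_sub_sq Y w c hw]
    simp [c]
  · have hmem := τ.pieceSpace.starProjection_apply_mem Y
    have hc : ∀ j, ∃ c : ℝ, ∀ i, τ.InSegment j i → τ.pieceSpace.starProjection Y i = c := by
      intro j
      have h1 := τ.one_le_pt j.castSucc
      have h2 := τ.pt_lt j
      have h3 := τ.pt_le j.succ
      refine ⟨τ.pieceSpace.starProjection Y ⟨τ.pt j.castSucc - 1, by omega⟩, fun i hi => ?_⟩
      refine hmem j _ _ hi ⟨?_, ?_⟩ <;> simp only <;> omega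
    choose c hc using hc
    rw [τ.norm_sub_sq Y _ c hc]
    refine le_add_of_nonneg_right (Finset.sum_nonneg fun j _ => ?_)
    have h2 : (τ.pt j.castSucc : ℝ) ≤ τ.pt j.succ := by exact_mod_cast (τ.pt_lt j).le
    exact mul_nonneg (sub_nonneg.2 h2) (sq_nonneg _)

/-- Charging `L * q` to every segment counts it once too often, as there is one segment more than
there are change-points. -/
lemma criterion_eq (L q : ℝ) (Y : EuclideanSpace ℝ (Fin n)) :
    τ.criterion L q Y = ‖Y‖ ^ 2 - L * q + ∑ j : Fin (τ.len + 1),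
      (segCost (psum fun i => Y i) n L (τ.pt j.castSucc) (τ.pt j.succ) + L * q) := by
  unfold criterion penalty segCost
  rw [τ.norm_sub_starProjection_sq]
  simp only [Finset.sum_add_distrib, Finset.sum_neg_distrib, ← Finset.mul_sum, Finset.sum_const,
    Finset.card_univ, Fintype.card_fin, nsmul_eq_mul, Int.cast_natCast]
  push_cast
  ring

end CPVector

/-! ### Change-point vectors as increasing lists, and splicing of lists. -/

/-- The sum of `J` over the consecutive pairs of a list. -/
def pathCost (J : ℕ → ℕ → ℝ) : List ℕ → ℝ
  | [] => 0
  | [_] => 0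
  | a :: b :: l => J a b + pathCost J (b :: l)

lemma pathCost_append (J : ℕ → ℕ → ℝ) (A : List ℕ) (a : ℕ) (B : List ℕ) :
    pathCost J (A ++ a :: B) = pathCost J (A ++ [a]) + pathCost J (a :: B) := by
  induction A with
  | nil => simp [pathCost]
  | cons x A ih =>
    cases A with
    | nil => simp [pathCost]
    | cons y A =>
      simp only [List.cons_append, pathCost] at ih ⊢
      rw [ih]
      ring

lemma pathCost_ofFn (J : ℕ → ℕ → ℝ) (k : ℕ) (f : Fin (k + 2) → ℕ) :
    pathCost J (List.ofFn f) = ∑ j : Fin (k + 1), J (f j.castSucc) (f j.succ) := by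
  induction k with
  | zero => simp [pathCost]
  | succ k ih =>
    rw [Fin.sum_univ_succ, List.ofFn_succ, List.ofFn_succ, pathCost]
    have := ih fun j => f j.succ
    rw [List.ofFn_succ] at this
    rw [this]
    rfl

/-- The list of the nodes of a change-point vector. -/
def CPVector.nodes {n : ℕ} (τ : CPVector n) : List ℕ := List.ofFn τ.pt

/-- The lists of nodes of change-point vectors. -/
structure IsPath (n : ℕ) (l : List ℕ) : Prop where
  chain : l.IsChain (· < ·)
  head : l.head? = some 1
  last : l.getLast? = some (n + 1)

lemma CPVector.isPath_nodes {n : ℕ} (τ : CPVector n) : IsPath n τ.nodes where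
  chain := by
    rw [← List.sortedLT_iff_isChain]
    exact List.sortedLT_ofFn_iff.2 τ.strictMono
  head := by
    unfold nodes
    rw [List.ofFn_succ, List.head?_cons, τ.pt_zero]
  last := by
    unfold nodes
    rw [List.ofFn_succ', List.concat_eq_append, List.getLast?_append_of_ne_nil _ (by simp)]
    simp [τ.pt_last]

/-- The hypothesis `1 ≤ n` separates the two end nodes and so excludes a one-element list. -/
lemma IsPath.exists_nodes_eq {n : ℕ} (hn : 1 ≤ n) {l : List ℕ} (h : IsPath n l) :
    ∃ τ : CPVector n, τ.nodes = l := by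
  match l, h with
  | [], h => exact absurd h.head (by simp)
  | [a], h =>
    have h1 := h.head
    have h2 := h.last
    simp only [List.head?_cons, List.getLast?_singleton, Option.some.injEq] at h1 h2
    omega
  | a :: b :: l, h =>
    refine ⟨⟨l.length, (a :: b :: l).get, ?_, ?_, ?_⟩, ?_⟩
    · exact (List.sortedLT_iff_isChain.2 h.chain).strictMono_get
    · have := h.head
      simpa using this
    · have := h.last
      rw [List.getLast?_eq_getElem?] at this
      simp only [List.length_cons, Nat.add_sub_cancel] at this
      rw [List.getElem?_eq_some_iff] at this
      obtain ⟨_, h2⟩ := this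
      exact h2
    · exact List.ofFn_get _

lemma IsPath.replace {n : ℕ} {A B mid mid' : List ℕ} {u v : ℕ}
    (h : IsPath n (A ++ u :: (mid ++ v :: B)))
    (h' : (u :: (mid' ++ [v])).IsChain (· < ·)) : IsPath n (A ++ u :: (mid' ++ v :: B)) where
  chain := by
    have h1 := h.chain
    rw [List.isChain_split] at h1 ⊢
    refine ⟨h1.1, ?_⟩
    have h2 := h1.2
    rw [← List.cons_append, List.isChain_split] at h2 ⊢
    exact ⟨h', h2.2⟩
  head := by
    have := h.head
    cases A <;> simpa using this
  last := by
    have := h.last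
    simpa [List.getLast?_append, List.getLast?_cons] using this

lemma criterion_eq_pathCost {n : ℕ} (τ : CPVector n) (L q : ℝ) (Y : EuclideanSpace ℝ (Fin n)) :
    τ.criterion L q Y = ‖Y‖ ^ 2 - L * q +
      pathCost (fun a b => segCost (psum fun i => Y i) n L a b + L * q) τ.nodes := by
  rw [τ.criterion_eq, CPVector.nodes, pathCost_ofFn]

/-- A minimizer of the criterion is not improved by changing the nodes between two nodes. -/
lemma IsPenalizedLSE.pathCost_le {n : ℕ} (hn : 1 ≤ n) {L q : ℝ} {Y : EuclideanSpace ℝ (Fin n)}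
    {τ : CPVector n} (h : IsPenalizedLSE L q Y τ) {A B mid mid' : List ℕ} {u v : ℕ}
    (hτ : τ.nodes = A ++ u :: (mid ++ v :: B)) (h' : (u :: (mid' ++ [v])).IsChain (· < ·)) :
    pathCost (fun a b => segCost (psum fun i => Y i) n L a b + L * q) (u :: (mid ++ [v])) ≤
      pathCost (fun a b => segCost (psum fun i => Y i) n L a b + L * q) (u :: (mid' ++ [v])) := by
  have hp := τ.isPath_nodes
  rw [hτ] at hp
  obtain ⟨σ, hσ⟩ := (hp.replace h').exists_nodes_eq hn
  have h1 := h σ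
  have split : ∀ (J : ℕ → ℕ → ℝ) (l : List ℕ), pathCost J (A ++ u :: (l ++ v :: B)) =
      pathCost J (A ++ [u]) + (pathCost J (u :: (l ++ [v])) + pathCost J (v :: B)) := by
    intro J l
    rw [pathCost_append, ← List.cons_append, pathCost_append J (u :: l), List.cons_append]
  rw [criterion_eq_pathCost, criterion_eq_pathCost, hτ, hσ, split, split] at h1
  linarith

/-- The set of nodes of a change-point vector. -/
def CPVector.nodeSet {n : ℕ} (τ : CPVector n) : Set ℤ := {p | ∃ a ∈ τ.nodes, (a : ℤ) = p}

lemma eq_cons_of_next {A B : List ℕ} {t v : ℕ} (hc : (A ++ t :: B).IsChain (· < ·))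
    (hv : v ∈ A ++ t :: B) (htv : t < v) (hbetween : ∀ p ∈ A ++ t :: B, p ≤ t ∨ v ≤ p) :
    ∃ B', B = v :: B' := by
  have hp := List.isChain_iff_pairwise.1 hc
  rw [List.pairwise_append] at hp
  have hvB : v ∈ B := by
    rcases List.mem_append.1 hv with h | h
    · have := hp.2.2 v h t (by simp)
      omega
    · rcases List.mem_cons.1 h with h | h
      · omega
      · exact h
  cases B with
  | nil => simp at hvB
  | cons c B' =>
    refine ⟨B', ?_⟩
    have hcons := List.pairwise_cons.1 hp.2.1
    have hcons' := List.pairwise_cons.1 hcons.2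
    have htc := hcons.1 c (by simp)
    have := hbetween c (by simp)
    rcases List.mem_cons.1 hvB with h | h
    · rw [h]
    · have := hcons'.1 v h
      omega

section nodeSet

variable {n : ℕ} (τ : CPVector n)

lemma mem_nodeSet_iff {p : ℤ} : p ∈ τ.nodeSet ↔ ∃ j, (τ.pt j : ℤ) = p := by
  simp only [CPVector.nodeSet, CPVector.nodes, List.mem_ofFn, Set.mem_ofPred_eq,
    exists_exists_eq_and]

lemma nodeSet_finite : τ.nodeSet.Finite := by
  have : τ.nodeSet = Set.range fun j => (τ.pt j : ℤ) := by
    ext p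
    exact mem_nodeSet_iff τ
  rw [this]
  exact Set.finite_range _

lemma one_mem_nodeSet : (1 : ℤ) ∈ τ.nodeSet :=
  (mem_nodeSet_iff τ).2 ⟨0, by rw [τ.pt_zero]; rfl⟩

lemma last_mem_nodeSet : (n : ℤ) + 1 ∈ τ.nodeSet :=
  (mem_nodeSet_iff τ).2 ⟨Fin.last _, by rw [τ.pt_last]; push_cast; rfl⟩

lemma exists_consec_next {N : Set ℤ} (hN : N.Finite) {t b : ℤ} (ht : t ∈ N) (hb : b ∈ N)
    (h : t < b) : ∃ v, Consec N t v := by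
  obtain ⟨v, hv, hmin⟩ := Set.exists_min_image {p ∈ N | t < p} id
    (hN.subset (Set.sep_subset _ _)) ⟨b, hb, h⟩
  refine ⟨v, ht, hv.1, hv.2, fun p hp => ?_⟩
  by_contra! hcon
  have := hmin p ⟨hp, hcon.1⟩
  simp only [id] at this
  omega

lemma exists_consec_prev {N : Set ℤ} (hN : N.Finite) {t a : ℤ} (ht : t ∈ N) (ha : a ∈ N)
    (h : a < t) : ∃ u, Consec N u t := by
  obtain ⟨u, hu, hmax⟩ := Set.exists_max_image {p ∈ N | p < t} id
    (hN.subset (Set.sep_subset _ _)) ⟨a, ha, h⟩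
  refine ⟨u, hu.1, ht, hu.2, fun p hp => ?_⟩
  by_contra! hcon
  have := hmax p ⟨hp, hcon.2⟩
  simp only [id] at this
  omega

lemma exists_consec_bracket {N : Set ℤ} (hN : N.Finite) {s a b : ℤ} (ha : a ∈ N) (hb : b ∈ N)
    (has : a < s) (hsb : s < b) (hs : s ∉ N) : ∃ u v, Consec N u v ∧ u < s ∧ s < v := by
  obtain ⟨u, hu, hmax⟩ := Set.exists_max_image {p ∈ N | p < s} id
    (hN.subset (Set.sep_subset _ _)) ⟨a, ha, has⟩
  obtain ⟨v, hv⟩ := exists_consec_next hN hu.1 hb (hu.2.trans hsb)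
  refine ⟨u, v, hv, hu.2, ?_⟩
  by_contra! hcon
  have hne : v ≠ s := fun h => hs (h ▸ hv.2.1)
  have := hmax v ⟨hv.2.1, by omega⟩
  have := hv.2.2.1
  simp only [id] at *
  omega

variable {τ}

lemma Consec.nat {u v : ℕ} (h : Consec τ.nodeSet u v) :
    u ∈ τ.nodes ∧ v ∈ τ.nodes ∧ u < v ∧ ∀ p ∈ τ.nodes, p ≤ u ∨ v ≤ p := by
  obtain ⟨⟨a, ha, hau⟩, ⟨b, hb, hbv⟩, h3, h4⟩ := h
  have ea : a = u := by exact_mod_cast hau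
  have eb : b = v := by exact_mod_cast hbv
  subst ea eb
  refine ⟨ha, hb, by exact_mod_cast h3, fun p hp => ?_⟩
  have := h4 p ⟨p, hp, rfl⟩
  omega

lemma Consec.exists_nodes_eq {u v : ℕ} (h : Consec τ.nodeSet u v) :
    ∃ A B, τ.nodes = A ++ u :: v :: B := by
  obtain ⟨hu, hv, huv, hb⟩ := h.nat
  obtain ⟨A, B, e⟩ := List.append_of_mem hu
  have hc := τ.isPath_nodes.chain
  rw [e] at hc hv hb
  obtain ⟨B', rfl⟩ := eq_cons_of_next hc hv huv hb
  exact ⟨A, B', e⟩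

lemma Consec.exists_eq_cons {A B : List ℕ} {u v : ℕ} (h : Consec τ.nodeSet u v)
    (e : τ.nodes = A ++ u :: B) : ∃ B', B = v :: B' := by
  obtain ⟨-, hv, huv, hb⟩ := h.nat
  have hc := τ.isPath_nodes.chain
  rw [e] at hc hv hb
  exact eq_cons_of_next hc hv huv hb

lemma nonneg_of_mem_nodeSet {p : ℤ} (h : p ∈ τ.nodeSet) : 0 ≤ p := by
  obtain ⟨a, -, rfl⟩ := h
  omega

end nodeSet

/-! ### The local changes that a minimizer withstands. -/

section localOptimality

variable {n : ℕ} {L q : ℝ} {Y : EuclideanSpace ℝ (Fin n)} {τ : CPVector n}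

lemma IsPenalizedLSE.ins (hn : 1 ≤ n) (h : IsPenalizedLSE L q Y τ) {u v w : ℤ}
    (huv : Consec τ.nodeSet u v) (h1 : u < w) (h2 : w < v) :
    segCost (psum fun i => Y i) n L u v ≤
      segCost (psum fun i => Y i) n L u w + segCost (psum fun i => Y i) n L w v + L * q := by
  have hu := nonneg_of_mem_nodeSet huv.1
  lift u to ℕ using hu
  lift w to ℕ using by omega
  lift v to ℕ using by omega
  obtain ⟨A, B, e⟩ := huv.exists_nodes_eq
  have := h.pathCost_le hn (mid := []) (mid' := [w]) e (by simp; omega)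
  simp only [List.nil_append, List.cons_append, pathCost] at this
  linarith

lemma IsPenalizedLSE.ins₂ (hn : 1 ≤ n) (h : IsPenalizedLSE L q Y τ) {u v w w' : ℤ}
    (huv : Consec τ.nodeSet u v) (h1 : u < w) (h2 : w < w') (h3 : w' < v) :
    segCost (psum fun i => Y i) n L u v ≤
      segCost (psum fun i => Y i) n L u w + segCost (psum fun i => Y i) n L w w' +
        segCost (psum fun i => Y i) n L w' v + 2 * (L * q) := by
  have hu := nonneg_of_mem_nodeSet huv.1
  lift u to ℕ using hu
  lift w to ℕ using by omega
  lift w' to ℕ using by omega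
  lift v to ℕ using by omega
  obtain ⟨A, B, e⟩ := huv.exists_nodes_eq
  have := h.pathCost_le hn (mid := []) (mid' := [w, w']) e (by simp; omega)
  simp only [List.nil_append, List.cons_append, pathCost] at this
  linarith

lemma segCost_self (F : ℤ → ℝ) (n L : ℝ) (a : ℤ) : segCost F n L a a = 0 := by
  simp [segCost, explained]

/-- When `l = u` or `w = v`, fewer nodes are inserted; the empty piece costs `0`, and `0 ≤ L * q`
covers the unused part of the allowance. -/
lemma IsPenalizedLSE.ins₃ (hn : 1 ≤ n) (hLq : 0 ≤ L * q) (h : IsPenalizedLSE L q Y τ)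
    {u v l t w : ℤ} (huv : Consec τ.nodeSet u v) (h1 : u ≤ l) (h2 : l < t) (h3 : t < w)
    (h4 : w ≤ v) :
    segCost (psum fun i => Y i) n L u v ≤
      segCost (psum fun i => Y i) n L u l + segCost (psum fun i => Y i) n L l t +
        segCost (psum fun i => Y i) n L t w + segCost (psum fun i => Y i) n L w v +
          3 * (L * q) := by
  rcases h1.eq_or_lt with rfl | h1
  · rw [segCost_self]
    rcases h4.eq_or_lt with rfl | h4
    · rw [segCost_self]
      have := h.ins hn huv h2 h3
      linarith
    · have := h.ins₂ hn huv h2 h3 h4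
      linarith
  · rcases h4.eq_or_lt with rfl | h4
    · rw [segCost_self]
      have := h.ins₂ hn huv h1 h2 h3
      linarith
    · have hu := nonneg_of_mem_nodeSet huv.1
      lift u to ℕ using hu
      lift l to ℕ using by omega
      lift t to ℕ using by omega
      lift w to ℕ using by omega
      lift v to ℕ using by omega
      obtain ⟨A, B, e⟩ := huv.exists_nodes_eq
      have := h.pathCost_le hn (mid := []) (mid' := [l, t, w]) e (by simp; omega)
      simp only [List.nil_append, List.cons_append, pathCost] at this
      linarith

lemma IsPenalizedLSE.rem (hn : 1 ≤ n) (h : IsPenalizedLSE L q Y τ) {u t v : ℤ}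
    (hut : Consec τ.nodeSet u t) (htv : Consec τ.nodeSet t v) :
    segCost (psum fun i => Y i) n L u t + segCost (psum fun i => Y i) n L t v + L * q ≤
      segCost (psum fun i => Y i) n L u v := by
  have hu := nonneg_of_mem_nodeSet hut.1
  have h1 := hut.2.2.1
  have h2 := htv.2.2.1
  lift u to ℕ using hu
  lift t to ℕ using by omega
  lift v to ℕ using by omega
  obtain ⟨A, B, e⟩ := hut.exists_nodes_eq
  obtain ⟨B', rfl⟩ := htv.exists_eq_cons (A := A ++ [u]) (B := B) (by simpa using e)
  have := h.pathCost_le hn (mid := [t]) (mid' := []) e (by simp; omega)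
  simp only [List.nil_append, List.cons_append, pathCost] at this
  linarith

lemma IsPenalizedLSE.move (hn : 1 ≤ n) (h : IsPenalizedLSE L q Y τ) {u t v w : ℤ}
    (hut : Consec τ.nodeSet u t) (htv : Consec τ.nodeSet t v) (huw : u < w) (hwv : w < v) :
    segCost (psum fun i => Y i) n L u t + segCost (psum fun i => Y i) n L t v ≤
      segCost (psum fun i => Y i) n L u w + segCost (psum fun i => Y i) n L w v := by
  have hu := nonneg_of_mem_nodeSet hut.1
  have h1 := hut.2.2.1
  have h2 := htv.2.2.1
  lift u to ℕ using hu
  lift t to ℕ using by omega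
  lift v to ℕ using by omega
  lift w to ℕ using by omega
  obtain ⟨A, B, e⟩ := hut.exists_nodes_eq
  obtain ⟨B', rfl⟩ := htv.exists_eq_cons (A := A ++ [u]) (B := B) (by simpa using e)
  have := h.pathCost_le hn (mid := [t]) (mid' := [w]) e (by simp; omega)
  simp only [List.nil_append, List.cons_append, pathCost] at this
  linarith

lemma IsPenalizedLSE.merge (hn : 1 ≤ n) (h : IsPenalizedLSE L q Y τ) {u' u t v w : ℤ}
    (hu'u : Consec τ.nodeSet u' u) (hut : Consec τ.nodeSet u t) (htv : Consec τ.nodeSet t v)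
    (huw : u' < w) (hwv : w < v) :
    segCost (psum fun i => Y i) n L u' u + segCost (psum fun i => Y i) n L u t +
        segCost (psum fun i => Y i) n L t v + L * q ≤
      segCost (psum fun i => Y i) n L u' w + segCost (psum fun i => Y i) n L w v := by
  have hu := nonneg_of_mem_nodeSet hu'u.1
  have h0 := hu'u.2.2.1
  have h1 := hut.2.2.1
  have h2 := htv.2.2.1
  lift u' to ℕ using hu
  lift u to ℕ using by omega
  lift t to ℕ using by omega
  lift v to ℕ using by omega
  lift w to ℕ using by omega
  obtain ⟨A, B, e⟩ := hu'u.exists_nodes_eq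
  obtain ⟨B', rfl⟩ := hut.exists_eq_cons (A := A ++ [u']) (B := B) (by simpa using e)
  obtain ⟨B'', rfl⟩ := htv.exists_eq_cons (A := A ++ [u', u]) (B := B') (by simpa using e)
  have := h.pathCost_le hn (mid := [u, t]) (mid' := [w]) e (by simp; omega)
  simp only [List.nil_append, List.cons_append, pathCost] at this
  linarith

end localOptimality

/-! ### Maximal inequality for sub-Gaussian partial sums. -/

section maximal

variable {Ω ι : Type*}

lemma lintegral_exp_le_one [MeasurableSpace Ω] {P : Measure Ω} {X : Ω → ℝ}
    (hX : HasSubgaussianMGF X 1 P) (lam : ℝ) :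
    ∫⁻ ω, ENNReal.ofReal (Real.exp (lam * X ω - lam ^ 2 / 2)) ∂P ≤ 1 := by
  have e : ∀ ω, Real.exp (lam * X ω - lam ^ 2 / 2) =
      Real.exp (lam * X ω) * Real.exp (-(lam ^ 2 / 2)) := fun ω => by
    rw [← Real.exp_add, sub_eq_add_neg]
  simp only [e]
  rw [← ofReal_integral_eq_lintegral_ofReal ((hX.integrable_exp_mul lam).mul_const _)
    (Filter.Eventually.of_forall fun ω => by positivity), integral_mul_const,
    ENNReal.ofReal_le_one]
  have h := hX.mgf_le lam
  unfold mgf at h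
  calc _ ≤ Real.exp ((1 : NNReal) * lam ^ 2 / 2) * Real.exp (-(lam ^ 2 / 2)) :=
        mul_le_mul_of_nonneg_right h (Real.exp_nonneg _)
    _ = 1 := by
        rw [← Real.exp_add]
        simp

/-- The exponential process of the partial sums `∑ j < d, ε (f j)`. -/
def expProcess (ε : ι → Ω → ℝ) (f : ℕ → ι) (lam : ℝ) (d : ℕ) (ω : Ω) : ℝ :=
  Real.exp (lam * ∑ j ∈ Finset.range d, ε (f j) ω - lam ^ 2 / 2 * d)

lemma expProcess_succ (ε : ι → Ω → ℝ) (f : ℕ → ι) (lam : ℝ) (d : ℕ) (ω : Ω) :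
    expProcess ε f lam (d + 1) ω =
      expProcess ε f lam d ω * Real.exp (lam * ε (f d) ω - lam ^ 2 / 2) := by
  unfold expProcess
  rw [← Real.exp_add, Finset.sum_range_succ]
  push_cast
  congr 1
  ring

/-- A maximal inequality for the partial sums of independent sub-Gaussian variables. -/
lemma measure_exists_expProcess_ge [mΩ : MeasurableSpace Ω] {P : Measure Ω}
    [IsProbabilityMeasure P] {ε : ι → Ω → ℝ} (hε : ∀ i, Measurable (ε i)) (hind : iIndepFun ε P)
    (hsub : ∀ i, HasSubgaussianMGF (ε i) 1 P) (f : ℕ → ι) (N : ℕ)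
    (hf : Set.InjOn f (Set.Iio N)) (lam a : ℝ) :
    ENNReal.ofReal a * P {ω | ∃ d ≤ N, a ≤ expProcess ε f lam d ω} ≤ 1 := by
  classical
  let M : ℕ → MeasurableSpace Ω := fun d =>
    ⨆ i ∈ f '' Set.Iio d, (inferInstance : MeasurableSpace ℝ).comap (ε i)
  have hM : ∀ d, M d ≤ mΩ := fun d => iSup₂_le fun i _ => (hε i).comap_le
  have hεM : ∀ d j, j < d → Measurable[M d] (ε (f j)) := fun d j hj => by
    refine Measurable.mono (comap_measurable (ε (f j))) ?_ le_rfl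
    exact le_iSup₂_of_le (f := fun i (_ : i ∈ f '' Set.Iio d) =>
      (inferInstance : MeasurableSpace ℝ).comap (ε i)) (f j) ⟨j, hj, rfl⟩ le_rfl
  have hproc : ∀ d d', d ≤ d' → Measurable[M d'] (expProcess ε f lam d) := fun d d' hd => by
    have : Measurable[M d'] fun ω => ∑ j ∈ Finset.range d, ε (f j) ω :=
      Finset.measurable_sum _ fun j hj => hεM d' j ((Finset.mem_range.1 hj).trans_le hd)
    exact Real.measurable_exp.comp ((this.const_mul lam).sub_const _)
  let B : ℕ → Set Ω := fun d => {ω | ∃ e ≤ d, a ≤ expProcess ε f lam e ω}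
  have hB : ∀ d, MeasurableSet[M d] (B d) := fun d => by
    have : B d = ⋃ e ∈ Set.Iic d, {ω | a ≤ expProcess ε f lam e ω} := by
      ext ω
      simp [B]
    rw [this]
    refine MeasurableSet.biUnion (Set.to_countable _) fun e he => ?_
    exact hproc e d he measurableSet_Ici
  -- This is the supermartingale stopped on reaching level `a`, with the value at the stopping time
  -- lowered to `a`. Its expectation starts at most at `1` and does not increase: outside `B d` the
  -- next factor is independent of the past and has mean at most `1`.
  have key : ∀ d ≤ N, ∫⁻ ω, ((B d).indicator (fun _ => ENNReal.ofReal a) ω +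
      (B d)ᶜ.indicator (fun ω => ENNReal.ofReal (expProcess ε f lam d ω)) ω) ∂P ≤ 1 := by
    intro d
    induction d with
    | zero =>
      intro _
      calc _ ≤ ∫⁻ _, 1 ∂P := by
            refine lintegral_mono fun ω => ?_
            by_cases hω : ω ∈ B 0
            · have : a ≤ 1 := by simpa [B, expProcess] using hω
              simp [hω, this]
            · simp [hω, expProcess]
        _ = 1 := by simp
    | succ d ih =>
      intro hd
      refine le_trans ?_ (ih (by omega))
      let Z : Ω → ℝ≥0∞ := fun ω => ENNReal.ofReal (Real.exp (lam * ε (f d) ω - lam ^ 2 / 2))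
      let W : Ω → ℝ≥0∞ := (B d)ᶜ.indicator fun ω => ENNReal.ofReal (expProcess ε f lam d ω)
      have hW : Measurable[M d] W :=
        (hproc d d le_rfl).ennreal_ofReal.indicator (hB d).compl
      have hZ : Measurable[⨆ i ∈ ({f d} : Set ι),
          (inferInstance : MeasurableSpace ℝ).comap (ε i)] Z := by
        have : Measurable[⨆ i ∈ ({f d} : Set ι),
            (inferInstance : MeasurableSpace ℝ).comap (ε i)] (ε (f d)) := by
          refine Measurable.mono (comap_measurable (ε (f d))) ?_ le_rfl
          simp
        exact (Real.measurable_exp.comp ((this.const_mul lam).sub_const _)).ennreal_ofReal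
      have hindep : Indep (M d) (⨆ i ∈ ({f d} : Set ι),
          (inferInstance : MeasurableSpace ℝ).comap (ε i)) P := by
        refine indep_iSup_of_disjoint (fun i => (hε i).comap_le) hind ?_
        rw [Set.disjoint_singleton_right]
        rintro ⟨j, hj, hjd⟩
        have hj' : j < d := hj
        have := hf (show j < N by omega) (show d < N by omega) hjd
        omega
      have hprod := lintegral_mul_eq_lintegral_mul_lintegral_of_independent_measurableSpace
        (hM d) (iSup₂_le fun i _ => (hε i).comap_le) hindep hW hZ
      have hmeasB := hM d _ (hB d)
      calc _ ≤ ∫⁻ ω, ((B d).indicator (fun _ => ENNReal.ofReal a) ω + W ω * Z ω) ∂P := by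
            refine lintegral_mono fun ω => ?_
            by_cases hω : ω ∈ B d
            · have hω' : ω ∈ B (d + 1) := by
                obtain ⟨e, he, h⟩ := hω
                exact ⟨e, by omega, h⟩
              simp [hω, hω', W]
            · have hs : W ω * Z ω = ENNReal.ofReal (expProcess ε f lam (d + 1) ω) := by
                simp only [W, Z, Set.indicator_of_mem (show ω ∈ (B d)ᶜ from hω)]
                rw [expProcess_succ, ENNReal.ofReal_mul (by unfold expProcess; positivity)]
              rw [hs]
              by_cases hω' : ω ∈ B (d + 1)
              · have : a ≤ expProcess ε f lam (d + 1) ω := by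
                  obtain ⟨e, he, h⟩ := hω'
                  rcases Nat.lt_or_ge d e with h1 | h1
                  · obtain rfl : e = d + 1 := by omega
                    exact h
                  · exact absurd ⟨e, h1, h⟩ hω
                simp [hω, hω', ENNReal.ofReal_le_ofReal this]
              · simp [hω, hω']
        _ = ∫⁻ ω, (B d).indicator (fun _ => ENNReal.ofReal a) ω ∂P + ∫⁻ ω, W ω * Z ω ∂P :=
            lintegral_add_left (measurable_const.indicator hmeasB) _
        _ ≤ ∫⁻ ω, (B d).indicator (fun _ => ENNReal.ofReal a) ω ∂P + ∫⁻ ω, W ω ∂P := by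
            refine add_le_add le_rfl ?_
            rw [hprod]
            exact mul_le_of_le_one_right' (lintegral_exp_le_one (hsub (f d)) lam)
        _ = _ := (lintegral_add_left (measurable_const.indicator hmeasB) _).symm
  have hfin := key N le_rfl
  rw [lintegral_add_left (measurable_const.indicator (hM N _ (hB N))),
    lintegral_indicator_const (hM N _ (hB N))] at hfin
  exact le_self_add.trans hfin

/-- The partial sums of independent sub-Gaussian variables stay below a line of slope `δ` after
the time `r`, except with exponentially small probability. -/
lemma measure_exists_abs_sum_gt_le [mΩ : MeasurableSpace Ω] {P : Measure Ω}
    [IsProbabilityMeasure P] {ε : ι → Ω → ℝ} (hε : ∀ i, Measurable (ε i)) (hind : iIndepFun ε P)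
    (hsub : ∀ i, HasSubgaussianMGF (ε i) 1 P) (f : ℕ → ι) (N : ℕ)
    (hf : Set.InjOn f (Set.Iio N)) {δ r x : ℝ} (hδ : 0 ≤ δ) (hx : x ≤ δ ^ 2 / 2 * r) :
    P {ω | ∃ d ≤ N, r ≤ d ∧ δ * d < |∑ j ∈ Finset.range d, ε (f j) ω|} ≤
      ENNReal.ofReal (2 * Real.exp (-x)) := by
  have hone : ∀ lam : ℝ, P {ω | ∃ d ≤ N, Real.exp x ≤ expProcess ε f lam d ω} ≤
      ENNReal.ofReal (Real.exp (-x)) := by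
    intro lam
    have h := measure_exists_expProcess_ge hε hind hsub f N hf lam (Real.exp x)
    have hpos : 0 < Real.exp x := Real.exp_pos x
    rw [mul_comm, ← ENNReal.le_div_iff_mul_le (Or.inl (by simpa using hpos)) (Or.inl (by simp))] at h
    rwa [one_div, ← ENNReal.ofReal_inv_of_pos hpos, ← Real.exp_neg] at h
  have hsubset : {ω | ∃ d ≤ N, r ≤ d ∧ δ * d < |∑ j ∈ Finset.range d, ε (f j) ω|} ⊆
      {ω | ∃ d ≤ N, Real.exp x ≤ expProcess ε f δ d ω} ∪
        {ω | ∃ d ≤ N, Real.exp x ≤ expProcess ε f (-δ) d ω} := by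
    rintro ω ⟨d, hd, hrd, hlt⟩
    -- With parameter `lam = ±δ`, a sum beyond `δ * d` makes the exponent exceed `δ ^ 2 * d - δ ^ 2
    -- / 2 * d`, which is at least `x`.
    have h1 : x ≤ δ ^ 2 / 2 * d := hx.trans (mul_le_mul_of_nonneg_left hrd (by positivity))
    rcases lt_abs.1 hlt with h | h
    · refine Or.inl ⟨d, hd, Real.exp_le_exp.2 ?_⟩
      have := mul_le_mul_of_nonneg_left h.le hδ
      nlinarith
    · refine Or.inr ⟨d, hd, Real.exp_le_exp.2 ?_⟩
      have := mul_le_mul_of_nonneg_left h.le hδ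
      nlinarith
  calc _ ≤ _ := measure_mono hsubset
    _ ≤ _ := measure_union_le _ _
    _ ≤ ENNReal.ofReal (Real.exp (-x)) + ENNReal.ofReal (Real.exp (-x)) :=
        add_le_add (hone _) (hone _)
    _ = _ := by
        rw [← ENNReal.ofReal_add (Real.exp_nonneg _) (Real.exp_nonneg _)]
        congr 1
        ring

end maximal

/-! ### From the statistical model to the local situation. -/

section

variable {n : ℕ}

lemma psum_succ (f : Fin n → ℝ) {k : ℕ} (hk : k < n) :
    psum f ((k : ℤ) + 2) = psum f ((k : ℤ) + 1) + f ⟨k, hk⟩ := by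
  rw [← sub_eq_iff_eq_add', psum_sub f (by omega), Finset.sum_eq_single ⟨k, hk⟩]
  · rw [if_pos (by simp only; omega)]
  · intro i _ hi
    refine if_neg fun h => hi (Fin.ext ?_)
    simp only
    omega
  · simp

lemma psum_signal {θ : EuclideanSpace ℝ (Fin n)} {τ : CPVector n} {μ : Fin (τ.len + 1) → ℝ}
    (h : IsChangePointRep θ τ μ) (j : Fin (τ.len + 1)) {a b : ℤ}
    (ha : (τ.pt j.castSucc : ℤ) ≤ a) (hab : a ≤ b) (hb : b ≤ τ.pt j.succ) :
    psum (fun i => θ i) b - psum (fun i => θ i) a = μ j * ((b : ℝ) - a) := by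
  have h1 := τ.one_le_pt j.castSucc
  have h2 := τ.pt_le j.succ
  rw [← psum_sub_const (n := n) (μ j) (by omega) hab (by omega)]
  exact psum_sub_congr hab fun i hi1 hi2 => h.2 j i ⟨by omega, by omega⟩

lemma segMean_signal {θ : EuclideanSpace ℝ (Fin n)} {τ : CPVector n} {μ : Fin (τ.len + 1) → ℝ}
    (h : IsChangePointRep θ τ μ) (j : Fin (τ.len + 1)) :
    segMean θ (τ.pt j.castSucc) (τ.pt j.succ) = μ j := by
  have h1 := τ.pt_lt j
  have h2 := sub_cast_pos (show (τ.pt j.castSucc : ℤ) < τ.pt j.succ by exact_mod_cast h1)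
  rw [segMean_eq_avg θ h1.le, avg, psum_signal h j le_rfl (by exact_mod_cast h1.le) le_rfl,
    mul_div_cancel_right₀ _ h2.ne']

lemma cusum_sq (y : EuclideanSpace ℝ (Fin n)) {a b c : ℕ} (hab : a < b) (hbc : b < c) :
    cusum y a b c ^ 2 = cusumSq (psum fun i => y i) a b c := by
  have h1 : (0 : ℝ) < (b : ℝ) - a := sub_pos.2 (by exact_mod_cast hab)
  have h2 : (0 : ℝ) < (c : ℝ) - b := sub_pos.2 (by exact_mod_cast hbc)
  have h3 : (0 : ℝ) < (c : ℝ) - a := by linarith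
  rw [cusumSq_eq _ (by exact_mod_cast hab) (by exact_mod_cast hbc), cusum,
    segMean_eq_avg y hab.le, segMean_eq_avg y hbc.le, mul_pow, Real.sq_sqrt (by positivity)]
  simp

lemma threshold_sq {q : ℝ} (hq : 0 < q) {a b c : ℕ} (ha : 1 ≤ a) (hab : a < b) (hbc : b < c)
    (hc : c ≤ n + 1) : threshold n q a b c ^ 2 = thresholdSq n q a b c := by
  have h1 : (0 : ℝ) < (b : ℝ) - a := sub_pos.2 (by exact_mod_cast hab)
  have h2 : (0 : ℝ) < (c : ℝ) - b := sub_pos.2 (by exact_mod_cast hbc)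
  have h3 : (0 : ℝ) < (c : ℝ) - a := by linarith
  have h4 : (c : ℝ) - b ≤ n := by
    have : c ≤ n + b := by omega
    have : (c : ℝ) ≤ n + b := by exact_mod_cast this
    linarith
  have h5 : (0 : ℝ) < n := by linarith
  have h6 : 0 ≤ Real.log (((n : ℝ) * ((c : ℝ) - a)) / (((c : ℝ) - b) * ((b : ℝ) - a))) := by
    refine Real.log_nonneg ((one_le_div (by positivity)).2 ?_)
    exact mul_le_mul h4 (by linarith) h1.le h5.le
  rw [threshold, Real.sq_sqrt (by linarith), thresholdSq,
    Real.log_div (by positivity) (by positivity), Real.log_mul h5.ne' h3.ne',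
    Real.log_mul h2.ne' h1.ne']
  push_cast
  ring

/-- The half-width of the largest window around `τ.cp k` without other change-points. -/
def CPVector.radius (τ : CPVector n) (k : Fin τ.len) : ℤ :=
  min ((τ.cp k : ℤ) - τ.prev k) ((τ.next k : ℤ) - τ.cp k)

lemma CPVector.prev_lt (τ : CPVector n) (k : Fin τ.len) : τ.prev k < τ.cp k :=
  τ.pt_lt k.castSucc

lemma CPVector.lt_next (τ : CPVector n) (k : Fin τ.len) : τ.cp k < τ.next k := by
  have := τ.pt_lt k.succ
  rwa [← Fin.succ_castSucc] at this

lemma CPVector.one_le_prev (τ : CPVector n) (k : Fin τ.len) : 1 ≤ τ.prev k :=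
  τ.one_le_pt _

lemma CPVector.next_le (τ : CPVector n) (k : Fin τ.len) : τ.next k ≤ n + 1 :=
  τ.pt_le _

/-- The weight `x * y / (x + y)` of a triad with gaps `x`, `y` is at most `min x y`. This bounds the
energy from above and the threshold from below in terms of the radius alone. -/
lemma signal_of_isHighEnergy {θ : EuclideanSpace ℝ (Fin n)} {τ : CPVector n}
    {μ : Fin (τ.len + 1) → ℝ} (h : IsChangePointRep θ τ μ) {k : Fin τ.len} {κ L q : ℝ}
    (hE : IsHighEnergy κ q θ τ k) (hκ : 0 ≤ κ) (hκL : 1000000 * L ≤ κ ^ 2) (hq : 0 < q) :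
    1000000 * L * (q + 2 * Real.log ((n : ℝ) / τ.radius k)) ≤
      (μ k.succ - μ k.castSucc) ^ 2 * τ.radius k := by
  have hp := τ.prev_lt k
  have hn := τ.lt_next k
  have h1 := τ.one_le_prev k
  have h2 := τ.next_le k
  have e1 : segMean θ (τ.prev k) (τ.cp k) = μ k.castSucc := segMean_signal h k.castSucc
  have e2 : segMean θ (τ.cp k) (τ.next k) = μ k.succ := segMean_signal h k.succ
  have hx : (0 : ℝ) < (τ.cp k : ℝ) - τ.prev k := sub_pos.2 (by exact_mod_cast hp)
  have hy : (0 : ℝ) < (τ.next k : ℝ) - τ.cp k := sub_pos.2 (by exact_mod_cast hn)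
  have hxy : (0 : ℝ) < (τ.next k : ℝ) - τ.prev k := by linarith
  have hm : (τ.radius k : ℝ) = min ((τ.cp k : ℝ) - τ.prev k) ((τ.next k : ℝ) - τ.cp k) := by
    unfold CPVector.radius
    push_cast
    rfl
  have hm0 : (0 : ℝ) < τ.radius k := by
    rw [hm]
    exact lt_min hx hy
  have hn0 : (0 : ℝ) < n := by
    have : 0 < n := by omega
    exact_mod_cast this
  have hmx : (τ.radius k : ℝ) ≤ (τ.cp k : ℝ) - τ.prev k := hm ▸ min_le_left _ _
  have hmy : (τ.radius k : ℝ) ≤ (τ.next k : ℝ) - τ.cp k := hm ▸ min_le_right _ _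
  have hprod : ((τ.cp k : ℝ) - τ.prev k) * ((τ.next k : ℝ) - τ.cp k) ≤
      τ.radius k * ((τ.next k : ℝ) - τ.prev k) := by
    rcases min_choice ((τ.cp k : ℝ) - τ.prev k) ((τ.next k : ℝ) - τ.cp k) with e | e
    · rw [hm, e]
      exact mul_le_mul_of_nonneg_left (by linarith) hx.le
    · rw [hm, e, mul_comm]
      exact mul_le_mul_of_nonneg_left (by linarith) hy.le
  unfold IsHighEnergy energy at hE
  rw [e1, e2] at hE
  have h0 : 0 ≤ κ * threshold n q (τ.prev k) (τ.cp k) (τ.next k) :=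
    mul_nonneg hκ (Real.sqrt_nonneg _)
  have hsq := pow_le_pow_left₀ h0 hE.le 2
  rw [mul_pow, mul_pow, sq_abs, Real.sq_sqrt (by positivity), threshold_sq hq h1 hp hn h2] at hsq
  have hthr : q + 2 * Real.log ((n : ℝ) / τ.radius k) ≤
      thresholdSq n q (τ.prev k) (τ.cp k) (τ.next k) := by
    have hlog := Real.log_le_log (by positivity) hprod
    rw [Real.log_mul hx.ne' hy.ne', Real.log_mul hm0.ne' hxy.ne'] at hlog
    rw [Real.log_div hn0.ne' hm0.ne', thresholdSq]
    push_cast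
    linarith
  have hnonneg : 0 ≤ q + 2 * Real.log ((n : ℝ) / τ.radius k) := by
    have : (τ.radius k : ℝ) ≤ n := by
      have : τ.radius k ≤ (n : ℤ) := by
        unfold CPVector.radius
        omega
      exact_mod_cast this
    have := Real.log_nonneg ((one_le_div hm0).2 this)
    linarith
  calc _ ≤ κ ^ 2 * thresholdSq n q (τ.prev k) (τ.cp k) (τ.next k) :=
        mul_le_mul hκL hthr hnonneg (sq_nonneg _)
    _ ≤ _ := hsq
    _ ≤ _ := mul_le_mul_of_nonneg_left ((div_le_iff₀ hxy).2 hprod) (sq_nonneg _)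

/-- The node set also contains the end points `1` and `n + 1`, which `dist1` ignores; neither is at
distance less than `m` from `s`. An infinite `dist1` needs no separate treatment. -/
lemma le_abs_of_le_dist1 {τ : CPVector n} {s : ℕ} {r : ℝ} {m : ℤ}
    (h : ENNReal.ofReal r ≤ τ.dist1 s) (h1 : m ≤ s - 1) (h2 : m ≤ (n : ℤ) + 1 - s) {p : ℤ}
    (hp : p ∈ τ.nodeSet) (hpm : |(p : ℝ) - s| < m) : r ≤ |(p : ℝ) - s| := by
  have hpm' : |p - s| < m := by exact_mod_cast hpm
  rw [abs_lt] at hpm'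
  obtain ⟨j, rfl⟩ := (mem_nodeSet_iff τ).1 hp
  induction j using Fin.cases with
  | zero =>
    rw [τ.pt_zero] at hpm'
    push_cast at hpm'
    omega
  | succ j =>
    induction j using Fin.lastCases with
    | last =>
      rw [Fin.succ_last, τ.pt_last] at hpm'
      push_cast at hpm'
      omega
    | cast j =>
      have := h.trans (iInf_le _ j)
      rw [ENNReal.ofReal_le_ofReal_iff (abs_nonneg _)] at this
      simpa [CPVector.cp] using this

/-- If the noise is controlled, a minimizer of the criterion has a change-point close to each
change-point of high energy. -/
lemma not_le_dist1 {θ Z : EuclideanSpace ℝ (Fin n)} {τ σ : CPVector n} {μ : Fin (τ.len + 1) → ℝ}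
    (hrep : IsChangePointRep θ τ μ) {k : Fin τ.len} {κ L q r : ℝ} (hL : 100 ≤ L) (hq : 10 < q)
    (hE : IsHighEnergy κ q θ τ k) (hκ : 0 ≤ κ) (hκL : 1000000 * L ≤ κ ^ 2)
    (hopt : IsPenalizedLSE L q (θ + Z) σ)
    (hnoise : ∀ t₁ t₂ t₃ : ℕ, 1 ≤ t₁ → t₁ < t₂ → t₂ < t₃ → t₃ ≤ n + 1 →
      |cusum Z t₁ t₂ t₃| ≤ 2 * threshold n q t₁ t₂ t₃)
    (hdev : ∀ p : ℤ, 1 ≤ p → p ≤ (n : ℤ) + 1 → r ≤ |(p : ℝ) - τ.cp k| →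
      |psum (fun i => Z i) p - psum (fun i => Z i) (τ.cp k)| ≤
        1 / 16 * |μ k.succ - μ k.castSucc| * |(p : ℝ) - τ.cp k|)
    (hr : 0 < r) : ¬ ENNReal.ofReal r ≤ σ.dist1 (τ.cp k) := by
  intro hdist
  have hprev := τ.prev_lt k
  have hnext := τ.lt_next k
  have h1 := τ.one_le_prev k
  have h2 := τ.next_le k
  have hm1 : τ.radius k ≤ (τ.cp k : ℤ) - τ.prev k := min_le_left _ _
  have hm2 : τ.radius k ≤ (τ.next k : ℤ) - τ.cp k := min_le_right _ _
  have hm : 1 ≤ τ.radius k := le_min (by omega) (by omega)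
  have hn : 1 ≤ n := by omega
  have hfar : ∀ p ∈ σ.nodeSet, |(p : ℝ) - τ.cp k| < τ.radius k → r ≤ |(p : ℝ) - τ.cp k| :=
    fun p hp hpm => le_abs_of_le_dist1 hdist (by omega) (by omega) hp hpm
  -- Positivity of `r` excludes `s` itself from the nodes, so the segment around `s` has `s`
  -- strictly inside.
  have hs : (τ.cp k : ℤ) ∉ σ.nodeSet := by
    intro hmem
    have hm0 : (0 : ℝ) < τ.radius k := by exact_mod_cast hm
    have := hfar _ hmem (by simpa using hm0)
    simp only [Int.cast_natCast, sub_self, abs_zero] at this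
    linarith
  have hsplit : ∀ p, psum (fun i => (θ + Z) i) p = psum (fun i => θ i) p + psum (fun i => Z i) p :=
    fun p => psum_add _ _ p
  refine LocalConfig.elim (F := psum fun i => (θ + Z) i) (E := psum fun i => Z i)
    (N := σ.nodeSet) (n := n) (L := L) (q := q) (μ₁ := μ k.castSucc) (μ₂ := μ k.succ) (r := r)
    (s := τ.cp k) (m := τ.radius k) ?_
  exact {
    hL := hL
    hq := hq
    one_le := hm
    le_n := by
      have : τ.radius k ≤ (n : ℤ) := by omega
      exact_mod_cast this
    signal := signal_of_isHighEnergy hrep hE hκ hκL (by linarith)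
    left := fun p hp1 hp2 => by
      have := psum_signal hrep k.castSucc (a := p) (b := τ.cp k)
        (show (τ.prev k : ℤ) ≤ p by omega) hp2 le_rfl
      rw [hsplit, hsplit]
      linarith
    right := fun p hp1 hp2 => by
      have := psum_signal hrep k.succ (a := τ.cp k) (b := p) le_rfl hp1
        (show p ≤ (τ.next k : ℤ) by omega)
      rw [hsplit, hsplit]
      linarith
    noise := fun a b c ha hab hbc hc => by
      lift a to ℕ using by omega
      lift b to ℕ using by omega
      lift c to ℕ using by omega
      rw [Nat.cast_lt] at hab hbc
      have h := pow_le_pow_left₀ (abs_nonneg _)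
        (hnoise a b c (by omega) hab hbc (by omega)) 2
      rw [sq_abs, cusum_sq Z hab hbc, mul_pow,
        threshold_sq (by linarith) (by omega) hab hbc (by omega)] at h
      linarith
    dev := fun p hp1 hp2 hp => by
      have := hdev p (by omega) (by omega) (by simpa using hp)
      simpa using this
    far := fun p hp hpm => by simpa using hfar p hp (by simpa using hpm)
    r_pos := hr
    consec_le := fun u v huv => by
      obtain ⟨i, rfl⟩ := (mem_nodeSet_iff σ).1 huv.1
      obtain ⟨j, rfl⟩ := (mem_nodeSet_iff σ).1 huv.2.1
      have h3 := σ.one_le_pt i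
      have h4 := σ.pt_le j
      have : (σ.pt j : ℤ) - σ.pt i ≤ n := by omega
      exact_mod_cast this
    bracket := exists_consec_bracket (nodeSet_finite σ) (one_mem_nodeSet σ) (last_mem_nodeSet σ)
      (by omega) (by omega) hs
    next := fun t ht h => exists_consec_next (nodeSet_finite σ) ht (last_mem_nodeSet σ) (by omega)
    prev := fun t ht h => exists_consec_prev (nodeSet_finite σ) ht (one_mem_nodeSet σ) (by omega)
    ins := fun u v w h h1 h2 => hopt.ins hn h h1 h2
    ins₃ := fun u v l t w h h1 h2 h3 h4 =>
      hopt.ins₃ hn (mul_nonneg (by linarith) (by linarith)) h h1 h2 h3 h4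
    rem := fun u t v h h' => hopt.rem hn h h'
    move := fun u t v w h h' h1 h2 => hopt.move hn h h' h1 h2
    merge := fun u' u t v w h h' h'' h1 h2 => hopt.merge hn h h' h'' h1 h2 }

/-- The coordinate of the time `s + j`, for `s + j ≤ n`. -/
def forwardIndex (hn : 0 < n) (s j : ℕ) : Fin n := ⟨min (s - 1 + j) (n - 1), by omega⟩

/-- The coordinate of the time `s - 1 - j`, for `1 ≤ s - 1 - j`. -/
def backwardIndex (hn : 0 < n) (s j : ℕ) : Fin n := ⟨min (s - 2 - j) (n - 1), by omega⟩

lemma sum_forward (hn : 0 < n) (f : Fin n → ℝ) {s : ℕ} (hs : 1 ≤ s) (d : ℕ) (hd : s + d ≤ n + 1) :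
    ∑ j ∈ Finset.range d, f (forwardIndex hn s j) = psum f ((s : ℤ) + d) - psum f s := by
  induction d with
  | zero => simp
  | succ d ih =>
    have h := psum_succ f (k := s - 1 + d) (by omega)
    rw [show ((s - 1 + d : ℕ) : ℤ) + 2 = (s : ℤ) + (d + 1 : ℕ) by omega,
      show ((s - 1 + d : ℕ) : ℤ) + 1 = (s : ℤ) + d by omega] at h
    rw [Finset.sum_range_succ, ih (by omega), h,
      show forwardIndex hn s d = ⟨s - 1 + d, by omega⟩ from Fin.ext (min_eq_left (by omega))]
    ring

lemma sum_backward (hn : 0 < n) (f : Fin n → ℝ) {s : ℕ} (hs : s ≤ n + 1) (d : ℕ) (hd : d < s) :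
    ∑ j ∈ Finset.range d, f (backwardIndex hn s j) = psum f s - psum f ((s : ℤ) - d) := by
  induction d with
  | zero => simp
  | succ d ih =>
    have h := psum_succ f (k := s - 2 - d) (by omega)
    rw [show ((s - 2 - d : ℕ) : ℤ) + 2 = (s : ℤ) - d by omega,
      show ((s - 2 - d : ℕ) : ℤ) + 1 = (s : ℤ) - (d + 1 : ℕ) by omega] at h
    rw [Finset.sum_range_succ, ih (by omega), h,
      show backwardIndex hn s d = ⟨s - 2 - d, by omega⟩ from Fin.ext (min_eq_left (by omega))]
    ring

/-- On this range the truncation at `n - 1`, needed only to make the index total, is inactive. -/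
lemma forwardIndex_injOn (hn : 0 < n) (s : ℕ) (hs : 1 ≤ s) :
    Set.InjOn (forwardIndex hn s) (Set.Iio (n + 1 - s)) := by
  intro i hi j hj h
  simp only [Set.mem_Iio] at hi hj
  have := congrArg Fin.val h
  simp only [forwardIndex] at this
  omega

lemma backwardIndex_injOn (hn : 0 < n) (s : ℕ) (hs : s ≤ n + 1) :
    Set.InjOn (backwardIndex hn s) (Set.Iio (s - 1)) := by
  intro i hi j hj h
  simp only [Set.mem_Iio] at hi hj
  have := congrArg Fin.val h
  simp only [backwardIndex] at this
  omega

/-- The partial sums of the noise on both sides of `s` stay below a line of slope `δ` beyond the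
distance `r`, except with exponentially small probability. -/
lemma measure_exists_psum_gt_le {Ω : Type*} [MeasurableSpace Ω] {P : Measure Ω}
    [IsProbabilityMeasure P] {ε : Fin n → Ω → ℝ} (hε : ∀ i, Measurable (ε i))
    (hind : iIndepFun ε P) (hsub : ∀ i, HasSubgaussianMGF (ε i) 1 P) {s : ℕ} (hn : 0 < n)
    (hs : 1 ≤ s) (hsn : s ≤ n + 1) {δ r x : ℝ} (hδ : 0 ≤ δ) (hx : x ≤ δ ^ 2 / 2 * r) :
    P {ω | ∃ p : ℤ, 1 ≤ p ∧ p ≤ (n : ℤ) + 1 ∧ r ≤ |(p : ℝ) - s| ∧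
        δ * |(p : ℝ) - s| < |psum (fun i => ε i ω) p - psum (fun i => ε i ω) s|} ≤
      ENNReal.ofReal (4 * Real.exp (-x)) := by
  have hf := measure_exists_abs_sum_gt_le hε hind hsub (forwardIndex hn s) (n + 1 - s)
    (forwardIndex_injOn hn s hs) hδ hx
  have hb := measure_exists_abs_sum_gt_le hε hind hsub (backwardIndex hn s) (s - 1)
    (backwardIndex_injOn hn s hsn) hδ hx
  have hsum : ENNReal.ofReal (2 * Real.exp (-x)) + ENNReal.ofReal (2 * Real.exp (-x)) =
      ENNReal.ofReal (4 * Real.exp (-x)) := by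
    rw [← ENNReal.ofReal_add (by positivity) (by positivity)]
    congr 1
    ring
  rw [← hsum]
  refine (measure_mono ?_).trans ((measure_union_le _ _).trans (add_le_add hf hb))
  rintro ω ⟨p, hp1, hp2, hr, hlt⟩
  rcases le_total (s : ℤ) p with hsp | hsp
  · obtain ⟨d, hd⟩ := Int.exists_add_of_le hsp
    subst hd
    have e : |(((s : ℤ) + (d : ℤ) : ℤ) : ℝ) - s| = d := by
      push_cast
      rw [add_sub_cancel_left, Nat.abs_cast]
    rw [e] at hr hlt
    refine Or.inl ⟨d, by omega, hr, ?_⟩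
    rwa [sum_forward hn (fun i => ε i ω) hs d (by omega)]
  · obtain ⟨d, hd⟩ : ∃ d : ℕ, p = (s : ℤ) - d := ⟨((s : ℤ) - p).toNat, by omega⟩
    subst hd
    have e : |(((s : ℤ) - (d : ℤ) : ℤ) : ℝ) - s| = d := by
      push_cast
      rw [sub_sub_cancel_left, abs_neg, Nat.abs_cast]
    rw [e] at hr hlt
    refine Or.inr ⟨d, by omega, hr, ?_⟩
    rwa [sum_backward hn (fun i => ε i ω) hsn d (by omega), abs_sub_comm]

end

end ChangePoint

end

/-! ### Choice of the constants and conclusion. -/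

theorem proposition5 :
    ∃ (L₀ q₀ c c' : ℝ) (κ : ℝ → ℝ), 1 < L₀ ∧ 0 < q₀ ∧ 0 < c ∧ 0 < c' ∧ (∀ L, 1 < κ L) ∧
      ∀ (L q : ℝ), L₀ ≤ L → q₀ < q →
      ∀ (n : ℕ) (θ : EuclideanSpace ℝ (Fin n)) (τ : ChangePoint.CPVector n)
        (μ : Fin (τ.len + 1) → ℝ), ChangePoint.IsChangePointRep θ τ μ →
      ∀ k : Fin τ.len, ChangePoint.IsHighEnergy (κ L) q θ τ k →
      ∀ (Ω : Type*) [MeasurableSpace Ω] (P : Measure Ω) [IsProbabilityMeasure P]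
        (ε : Fin n → Ω → ℝ), (∀ i, Measurable (ε i)) → iIndepFun ε P →
        (∀ i, ∫ ω, ε i ω ∂P = 0) → (∀ i, HasSubgaussianMGF (ε i) 1 P) →
      ∀ τhat : Ω → ChangePoint.CPVector n,
        (∀ ω, ChangePoint.IsPenalizedLSE L q (θ + ChangePoint.noiseVec ε ω) (τhat ω)) →
      ∀ x : ℝ, 1 ≤ x →
        P {ω | ENNReal.ofReal (c * x / (μ k.succ - μ k.castSucc) ^ 2) ≤
            (ChangePoint.noiseEvent ε q).indicator (fun ω => (τhat ω).dist1 (τ.cp k)) ω} ≤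
          ENNReal.ofReal (c' * Real.exp (-x)) := by
  -- The slope `δ = |Δ| / 16` gives `δ ^ 2 / 2 = Δ ^ 2 / 512`, hence `512`. The factor `4` counts
  -- two sides of `s` and two signs, and the square of `1000 * (1 + |L|)` dominates `1000000 * L`.
  refine ⟨100, 10, 512, 4, fun L => 1000 * (1 + |L|), by norm_num, by norm_num, by norm_num,
    by norm_num, fun L => ?_, ?_⟩
  · have := abs_nonneg L
    linarith
  intro L q hL hq n θ τ μ hrep k hE Ω _ P _ ε hε hind _ hsub τhat hopt x hx
  have hprev := τ.prev_lt k
  have h1 := τ.one_le_prev k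
  have hnext := τ.lt_next k
  have h2 := τ.next_le k
  have hΔ : 0 < (μ k.succ - μ k.castSucc) ^ 2 := by
    have := hrep.1 k
    have : μ k.succ - μ k.castSucc ≠ 0 := sub_ne_zero.2 this.symm
    positivity
  have hr : 0 < 512 * x / (μ k.succ - μ k.castSucc) ^ 2 := by positivity
  have hκ : 0 ≤ 1000 * (1 + |L|) := by positivity
  have hκL : 1000000 * L ≤ (1000 * (1 + |L|)) ^ 2 := by
    rw [abs_of_nonneg (by linarith)]
    nlinarith
  refine (measure_mono ?_).trans (ChangePoint.measure_exists_psum_gt_le hε hind hsub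
    (s := τ.cp k) (δ := 1 / 16 * |μ k.succ - μ k.castSucc|)
    (r := 512 * x / (μ k.succ - μ k.castSucc) ^ 2) (by omega) (by omega) (by omega)
    (by positivity) (le_of_eq ?_))
  · intro ω hω
    -- Only an inclusion of events is proved, so `τhat` needs no measurability. Off `noiseEvent` the
    -- indicator is `0`, below the positive radius.
    by_cases hmem : ω ∈ ChangePoint.noiseEvent ε q
    · rw [Set.mem_ofPred_eq, Set.indicator_of_mem hmem] at hω
      by_contra hcon
      refine ChangePoint.not_le_dist1 hrep hL hq hE hκ hκL (hopt ω) hmem ?_ hr hω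
      intro p hp1 hp2 hp
      by_contra! hlt
      exact hcon ⟨p, hp1, hp2, hp, hlt⟩
    · rw [Set.mem_ofPred_eq, Set.indicator_of_notMem hmem, nonpos_iff_eq_zero,
        ENNReal.ofReal_eq_zero] at hω
      linarith
  · rw [mul_pow, sq_abs]
    generalize (μ k.succ - μ k.castSucc) ^ 2 = D at hΔ
    field_simp
    norm_num
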